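/- Assume GCH. Let $\kappa$ be a strongly compact cardinal (uncountable, regular, and every $\kappa$-complete proper filter on a set extends to a $\kappa$-complete ultrafilter) and let $\theta>\kappa$ be a regular cardinal. Let $P_{\kappa,\theta}$ be the set of partial functions from $\theta$ to $\kappa$ with domain of size $<\kappa$, ordered by extension, and let $B$ be its completion, i.e. the complete Boolean algebra of regular open (downward closed) subsets of $P_{\kappa,\theta}$. A *name* is a function $x:A(x)\to V$ whose domain $A(x)$ is a maximal antichain of $B$. For names $x,y$ and a relation $R\in\{=,\in\}$ let $[\![x\,R\,y]\!]=\bigvee\{a\wedge b: a\in A(x),\ b\in A(y),\ x(a)\,R\,y(b)\}$. Given an ultrafilter $U$ on $B$, the Boolean ultrapower $(M^-,\in^-)$ consists of the classes $[x]$ of names modulo $[\![x=y]\!]\in U$, with $[x]\in^-[y]$ iff $[\![x\in y]\!]\in U$. If it has a transitive collapse $M$, let $x^U\in M$ be the image of $[x]$ under the collapse, and let $j:V\to M$ map $v$ to $\check v^U$, where $\check v$ is the name $\{(\mathbb 1,v)\}$. **Lemma.** There is a $\kappa$-complete ultrafilter $U$ on $B$ such that the Boolean ultrapower $(M^-,\in^-)$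 has a transitive collapse $M$, and the following hold: (a) $j:(V,\in)\to(M,\in)$ is an elementary embedding, and $M$ is closed under sequences of length $<\kappa$. (b) The elements of $M$ are exactly the $x^U$ for names $x$ with $|A(x)|=\kappa$. Similarly, for every set $Y$, the elements of $j(Y)$ are exactly the $x^U$ for names $x$ with $|A(x)|=\kappa$ all of whose values are in $Y$. (c) If $|A|<\kappa$, then $j(A)=j''A$. In particular, $j$ restricted to $\kappa$ is the identity. (d) $j$ maps ordinals to ordinals and has critical point $\kappa$; moreover $\mathrm{cf}(j(\kappa))=\theta$ and $\theta\le j(\kappa)\le\theta^+$. (e) If $\lambda>\kappa$ is a regular cardinal, then $\max(\theta,\lambda)\le j(\lambda)<\max(\theta,\lambda)^+$. (f) Let $\lambda>\kappa$ be a cardinal and let $S=(D,R)$ be a set $D$ with a transitive relation $R\subseteq D\times D$ (for example a partial order, a strict partial order or a quasi-order) that is ${<}\lambda$-directed, i.e. every subset of $D$ of size $<\lambda$ has an $R$-upper bound in $D$. Then $j''D$ is cofinal in $j(S)=(j(D),j(R))$: for every $x\in j(D)$ there is $s\in D$ with $(x,j(s))\in j(R)$. (g) If $\alpha$ is an ordinal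 with $\mathrm{cf}(\alpha)\ne\kappa$, then $j''\alpha$ is cofinal in $j(\alpha)$, and $\mathrm{cf}(j(\alpha))=\mathrm{cf}(\alpha)$. -/

import Mathlib

universe u

namespace BooleanUltrapower

open Cardinal

/-! ### Set-theoretic hypotheses

The universe `V` of set theory is `ZFSet.{u}`; its cardinals and ordinals are those of level `u`. -/

/-- The generalized continuum hypothesis. -/
def GCH : Prop :=
  ∀ c : Cardinal.{u}, ℵ₀ ≤ c → (2 : Cardinal.{u}) ^ c = Order.succ c

/-- `κ` is strongly compact: it is an uncountable regular cardinal, and every (proper)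
`κ`-complete filter on any set extends to a `κ`-complete ultrafilter. -/
def StronglyCompact (κ : Cardinal.{u}) : Prop :=
  ℵ₀ < κ ∧ κ.IsRegular ∧
    ∀ (X : Type u) (F : Filter X), F.NeBot → CardinalInterFilter F κ →
      ∃ W : Ultrafilter X, (W : Filter X) ≤ F ∧ CardinalInterFilter (W : Filter X) κ

/-! ### The forcing notion and its completion -/

/-- Conditions: partial functions from `θ` to `κ` with domain of size `< κ`
(the value `none` means that the function is undefined at the argument). -/
structure Cond (κ θ : Cardinal.{u}) : Type u where
  toFun : θ.ord.ToType → Option κ.ord.ToType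
  small : #{δ // toFun δ ≠ none} < κ

/-- Conditions are ordered by extension: `p ≤ q` (`p` is stronger) if `p` extends `q`. -/
instance (κ θ : Cardinal.{u}) : PartialOrder (Cond κ θ) where
  le p q := ∀ δ i, q.toFun δ = some i → p.toFun δ = some i
  le_refl _ _ _ h := h
  le_trans _ _ _ hpq hqr δ i h := hpq δ i (hqr δ i h)
  le_antisymm p q hpq hqp := by
    obtain ⟨f, hf⟩ := p
    obtain ⟨g, hg⟩ := q
    have : f = g := funext fun δ => Option.ext fun i => ⟨hqp δ i, hpq δ i⟩
    subst this
    rfl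

/-- The algebra of regular elements of a complete Heyting algebra is a complete Boolean algebra. -/
noncomputable instance {α : Type*} [Order.Frame α] :
    CompleteBooleanAlgebra (Heyting.Regular α) :=
  { (inferInstance : BooleanAlgebra (Heyting.Regular α)) with
    sSup := (Heyting.Regular.gi (α := α)).liftCompleteLattice.sSup
    sInf := (Heyting.Regular.gi (α := α)).liftCompleteLattice.sInf
    isLUB_sSup := (Heyting.Regular.gi (α := α)).liftCompleteLattice.isLUB_sSup
    isGLB_sInf := (Heyting.Regular.gi (α := α)).liftCompleteLattice.isGLB_sInf }

/-- The regular open algebra of a poset: the downward closed sets `A` with `Aᶜᶜ = A`, where `Aᶜ`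
is the set of all conditions without an extension in `A`. -/
abbrev RegularOpen (P : Type u) [Preorder P] : Type u := Heyting.Regular (LowerSet P)

/-- The complete Boolean algebra generated by the forcing notion `Cond κ θ`. -/
abbrev CohenAlgebra (κ θ : Cardinal.{u}) : Type u := RegularOpen (Cond κ θ)

/-! ### Ultrafilters and names -/

/-- An ultrafilter on a Boolean algebra. -/
structure BAUltrafilter (B : Type u) [BooleanAlgebra B] where
  toPFilter : Order.PFilter B
  bot_notMem : ⊥ ∉ toPFilter
  mem_or_compl_mem : ∀ b : B, b ∈ toPFilter ∨ bᶜ ∈ toPFilter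

/-- `U` is `κ`-complete: it is closed under infima of fewer than `κ` elements. -/
def BAUltrafilter.IsComplete {B : Type u} [CompleteBooleanAlgebra B] (U : BAUltrafilter B)
    (κ : Cardinal.{u}) : Prop :=
  ∀ S : Set B, #S < κ → (∀ b ∈ S, b ∈ U.toPFilter) → sInf S ∈ U.toPFilter

/-- A maximal antichain of nonzero elements of a Boolean algebra. -/
structure IsMaximalAntichain {B : Type u} [BooleanAlgebra B] (A : Set B) : Prop where
  ne_bot : ∀ a ∈ A, a ≠ ⊥
  disjoint : ∀ a ∈ A, ∀ b ∈ A, a ≠ b → Disjoint a b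
  maximal : ∀ b : B, b ≠ ⊥ → ∃ a ∈ A, ¬ Disjoint a b

/-- A Boolean ultrapower name: a maximal antichain labelled with sets. -/
structure BUPName (B : Type u) [BooleanAlgebra B] : Type (u + 1) where
  antichain : Set B
  isMaximal : IsMaximalAntichain antichain
  label : antichain → ZFSet.{u}

section Ultrapower

variable {B : Type u} [CompleteBooleanAlgebra B]

/-- The Boolean value of `R x y`, where `R` is a binary relation on `V`. The elements `a ⊓ b` with
`a`, `b` from the two antichains form a common refinement (apart from zero elements). -/
def BUPName.val (R : ZFSet.{u} → ZFSet.{u} → Prop) (x y : BUPName B) : B :=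
  sSup {c | ∃ (a : x.antichain) (b : y.antichain),
    R (x.label a) (y.label b) ∧ c = (a : B) ⊓ (b : B)}

theorem BUPName.val_inf_le {R S T : ZFSet.{u} → ZFSet.{u} → Prop} (x y z : BUPName B)
    (h : ∀ u v w, R u v → S v w → T u w) :
    x.val R y ⊓ y.val S z ≤ x.val T z := by
  rw [BUPName.val, BUPName.val, sSup_inf_sSup]
  refine iSup₂_le ?_
  rintro ⟨_, _⟩ ⟨⟨a, b, hR, rfl⟩, ⟨b', c, hS, rfl⟩⟩
  by_cases hb : b = b'
  · subst hb
    refine le_trans ?_ (le_sSup ⟨a, c, h _ _ _ hR hS, rfl⟩)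
    exact le_inf (inf_le_left.trans inf_le_left) (inf_le_right.trans inf_le_right)
  · have hd : (b : B) ⊓ (b' : B) = ⊥ :=
      (y.isMaximal.disjoint _ b.2 _ b'.2 fun e => hb (Subtype.ext e)).eq_bot
    have : ((a : B) ⊓ b) ⊓ ((b' : B) ⊓ c) ≤ (b : B) ⊓ (b' : B) :=
      le_inf (inf_le_left.trans inf_le_right) (inf_le_right.trans inf_le_left)
    exact this.trans (hd.le.trans bot_le)

theorem BUPName.val_eq_self (x : BUPName B) : x.val (· = ·) x = ⊤ := by
  by_contra hne
  have hc : (x.val (· = ·) x)ᶜ ≠ ⊥ := fun e => hne (compl_eq_bot.mp e)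
  obtain ⟨a, ha, hd⟩ := x.isMaximal.maximal _ hc
  refine hd ((le_compl_iff_disjoint_right).mp ?_)
  rw [compl_compl]
  exact le_sSup ⟨⟨a, ha⟩, ⟨a, ha⟩, rfl, (inf_idem a).symm⟩

theorem BUPName.val_eq_comm (x y : BUPName B) : x.val (· = ·) y = y.val (· = ·) x := by
  unfold BUPName.val
  congr 1
  ext c
  constructor
  · rintro ⟨a, b, h, rfl⟩
    exact ⟨b, a, h.symm, inf_comm _ _⟩
  · rintro ⟨a, b, h, rfl⟩
    exact ⟨b, a, h.symm, inf_comm _ _⟩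

/-- Two names are equivalent if the Boolean value of their equality is in `U`. -/
def nameSetoid (U : BAUltrafilter B) : Setoid (BUPName B) where
  r x y := x.val (· = ·) y ∈ U.toPFilter
  iseqv :=
    { refl := fun x => by rw [x.val_eq_self]; exact Order.PFilter.top_mem
      symm := fun h => by rwa [BUPName.val_eq_comm]
      trans := fun h h' => Order.PFilter.mem_of_le
        (BUPName.val_inf_le _ _ _ fun _ _ _ e e' => e.trans e') (Order.PFilter.inf_mem h h') }

/-- The Boolean ultrapower (before the transitive collapse): equivalence classes of names. -/
def Ultrapower (U : BAUltrafilter B) : Type (u + 1) := Quotient (nameSetoid U)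

/-- The equivalence class of a name. -/
def Ultrapower.mk (U : BAUltrafilter B) (x : BUPName B) : Ultrapower U :=
  Quotient.mk (nameSetoid U) x

theorem mem_congr_aux (U : BAUltrafilter B) {x y x' y' : BUPName B}
    (hx : x.val (· = ·) x' ∈ U.toPFilter) (hy : y.val (· = ·) y' ∈ U.toPFilter)
    (h : x.val (· ∈ ·) y ∈ U.toPFilter) : x'.val (· ∈ ·) y' ∈ U.toPFilter := by
  rw [BUPName.val_eq_comm] at hx
  have h1 : x'.val (· ∈ ·) y ∈ U.toPFilter := Order.PFilter.mem_of_le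
    (BUPName.val_inf_le x' x y fun u v w (e : u = v) (m : v ∈ w) => (e ▸ m : u ∈ w))
    (Order.PFilter.inf_mem hx h)
  exact Order.PFilter.mem_of_le
    (BUPName.val_inf_le x' y y' fun u v w (m : u ∈ v) (e : v = w) => (e ▸ m : u ∈ w))
    (Order.PFilter.inf_mem h1 hy)

/-- The membership relation of the Boolean ultrapower: `[x]` is a member of `[y]` if the Boolean
value of `x ∈ y` is in `U`. -/
def Ultrapower.Mem (U : BAUltrafilter B) : Ultrapower U → Ultrapower U → Prop :=
  Quotient.lift₂ (fun x y : BUPName B => x.val (· ∈ ·) y ∈ U.toPFilter)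
    fun _ _ _ _ hx hy => propext ⟨mem_congr_aux U hx hy,
      mem_congr_aux U ((nameSetoid U).symm hx) ((nameSetoid U).symm hy)⟩

theorem BAUltrafilter.top_ne_bot (U : BAUltrafilter B) : (⊤ : B) ≠ ⊥ := fun e =>
  U.bot_notMem (e ▸ Order.PFilter.top_mem)

/-- The standard name of a set `v`: the antichain `{⊤}` with the label `v`. -/
def checkName (U : BAUltrafilter B) (v : ZFSet.{u}) : BUPName B where
  antichain := {⊤}
  isMaximal :=
    { ne_bot := by rintro a rfl; exact U.top_ne_bot
      disjoint := by rintro a rfl b rfl h; exact (h rfl).elim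
      maximal := fun b hb => ⟨⊤, rfl, fun h => hb (top_disjoint.mp h)⟩ }
  label _ := v

/-- `π` is the transitive collapse of the structure `(α, E)`: an isomorphism of `(α, E)` onto a
transitive class. -/
structure IsTransitiveCollapse {α : Type (u + 1)} (E : α → α → Prop) (π : α → ZFSet.{u}) :
    Prop where
  injective : Function.Injective π
  mem_iff : ∀ x z, z ∈ π x ↔ ∃ y, E y x ∧ π y = z

/-- The class `M`: the range of the collapse `π`. -/
def collapseClass {U : BAUltrafilter B} (π : Ultrapower U → ZFSet.{u}) : Set ZFSet.{u} :=
  Set.range π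

/-- The element of `M` given by a name: the collapse of its equivalence class. -/
def collapseName {U : BAUltrafilter B} (π : Ultrapower U → ZFSet.{u}) (x : BUPName B) :
    ZFSet.{u} :=
  π (Ultrapower.mk U x)

/-- The map `j : V → M`, which sends `v` to the collapse of the class of its standard name. -/
def embedding {U : BAUltrafilter B} (π : Ultrapower U → ZFSet.{u}) (v : ZFSet.{u}) : ZFSet.{u} :=
  collapseName π (checkName U v)

end Ultrapower

/-! ### Elementarity, closure, critical points -/

/-- The symbols of the language of set theory: one binary relation symbol. -/
inductive MemSymbol : ℕ → Type
  | mem : MemSymbol 2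

/-- The first-order language of set theory. -/
abbrev setLanguage : FirstOrder.Language := ⟨fun _ => Empty, MemSymbol⟩

/-- The structure `(V, ∈)`. -/
instance : setLanguage.Structure ZFSet.{u} where
  funMap := fun f => f.elim
  RelMap := fun {_} r => match r with
    | MemSymbol.mem => fun v => v 0 ∈ v 1

/-- The structure `(M, ∈)` for a class `M`. -/
instance (M : Set ZFSet.{u}) : setLanguage.Structure M where
  funMap := fun f => f.elim
  RelMap := fun {_} r => match r with
    | MemSymbol.mem => fun v => (v 0 : ZFSet.{u}) ∈ (v 1 : ZFSet.{u})

/-- `j` is an elementary embedding of `(V, ∈)` into `(M, ∈)`. -/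
def IsElementary (M : Set ZFSet.{u}) (j : ZFSet.{u} → ZFSet.{u}) : Prop :=
  ∃ e : FirstOrder.Language.ElementaryEmbedding setLanguage ZFSet.{u} M, ∀ v, (e v : ZFSet.{u}) = j v

/-- The class `M` is closed under sequences of length `< κ`: every function from an ordinal
`α < κ` to a set of elements of `M` is an element of `M`. -/
def ClosedUnderSeq (M : Set ZFSet.{u}) (κ : Cardinal.{u}) : Prop :=
  ∀ α < κ.ord, ∀ y f : ZFSet.{u}, (∀ z ∈ y, z ∈ M) → ZFSet.IsFunc α.toZFSet y f → f ∈ M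

/-- `α` is the critical point of `j`: the least ordinal moved by `j`. -/
def IsCriticalPoint (j : ZFSet.{u} → ZFSet.{u}) (α : Ordinal.{u}) : Prop :=
  j α.toZFSet ≠ α.toZFSet ∧ ∀ β < α, j β.toZFSet = β.toZFSet

/-- The value `j(α)` at an ordinal `α`, as an ordinal (the rank of the von Neumann ordinal
`j(α)`). -/
noncomputable def onOrd (j : ZFSet.{u} → ZFSet.{u}) (α : Ordinal.{u}) : Ordinal.{u} :=
  (j α.toZFSet).rank

/-! ### Directed orders -/

/-- `(D, R)` is a `< l`-directed order: `R` is a transitive relation on the set `D`, given as a set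
of ordered pairs, and every subset of `D` of size `< l` has an upper bound. (Reflexivity or
irreflexivity, and antisymmetry, are not required, so that partial orders, strict partial orders
and quasi-orders are all covered.) -/
structure IsDirectedOrder (l : Cardinal.{u}) (D R : ZFSet.{u}) : Prop where
  subset_prod : R ⊆ ZFSet.prod D D
  trans : ∀ a b c : ZFSet.{u}, ZFSet.pair a b ∈ R → ZFSet.pair b c ∈ R → ZFSet.pair a c ∈ R
  directed : ∀ A : ZFSet.{u}, A ⊆ D → A.card < l → ∃ t ∈ D, ∀ s ∈ A, ZFSet.pair s t ∈ R

end BooleanUltrapower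

namespace BooleanUltrapower

open Cardinal Set

/-! ### Cardinal arithmetic -/

/-! The ultrafilter on the algebra is induced by a `κ`-complete ultrafilter `W` on the set of
conditions that contains every dense open set: a regular open set is large when it belongs to `W`. A
name then becomes a function on conditions that is locally constant on a dense set (`Loc`), and
Boolean values become statements about `W`-almost every condition (`BUPName.val_mem_iff`). So the
Boolean ultrapower is the ultrapower by `W` restricted to such functions. They are closed under
composition with arbitrary maps, so witnesses can be chosen pointwise, and the theorem of Łoś holds
(`realize_iff_eventually`). Completeness of `W` gives well-foundedness, closure under short
sequences and the identity below `κ`.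

The size estimates rest on `exists_livesOn`. Under GCH a set of at most `κ` coordinates carries at
most `κ` conditions, and closing off in `κ` steps shows that every densely locally constant function
is decided on such a set. Hence it has at most `κ` decided values (`exists_small_range`). This gives
the antichains of size `κ`, the bounds in directed orders and the cofinality statement above `κ`.
Coding a function by its graph on the relevant conditions bounds the cardinality of `j(λ)`
(`card_onOrd_le`).

For the cofinality of `j(κ)`, `W` is also required to contain all sets `Above y δ`, where `y` is
decided by coordinates below `δ`. Fewer than `κ` of these have a common element, by a fusion along
the coordinates involved (`exists_forall_mem_above`), so strong compactness provides `W`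
(`exists_ultrafilter_cond`). The generic ordinals then increase with `δ`. They are cofinal in
`j(κ)`, because the at most `κ` coordinates deciding a given `y` are bounded in the regular cardinal
`θ`. -/

theorem exists_forall_lt_of_mk_lt {μ : Cardinal.{u}} (hμ : μ.IsRegular) {ι : Type u}
    (hι : #ι < μ) (f : ι → μ.ord.ToType) : ∃ γ, ∀ i, f i < γ := by
  have h : ¬ IsCofinal (range f) := fun hc => by
    have := Order.cof_le hc
    rw [Ordinal.cof_toType, hμ.cof_ord] at this
    exact (this.trans mk_range_le).not_gt hι
  simp only [IsCofinal, not_forall] at h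
  obtain ⟨γ, hγ⟩ := h
  refine ⟨γ, fun i => ?_⟩
  by_contra hi
  exact hγ ⟨_, mem_range_self i, not_lt.mp hi⟩

theorem mk_Iio_ord_toType_lt {μ : Cardinal.{u}} (i : μ.ord.ToType) : #(Iio i) < μ := by
  simpa using mk_Iio_lt i (by simp)

theorem mk_iUnion_le_of_forall_le {c : Cardinal.{u}} (hc : ℵ₀ ≤ c) {ι α : Type u} (hι : #ι ≤ c)
    {f : ι → Set α} (hf : ∀ i, #(f i) ≤ c) : #(⋃ i, f i) ≤ c :=
  mk_iUnion_le_sum_mk.trans <| (sum_le_sum _ _ hf).trans <| by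
    rw [sum_const, lift_id, lift_id]
    exact mul_le_of_le hc hι le_rfl

theorem GCH.two_power_le (h : GCH.{u}) {c μ : Cardinal.{u}} (hμ : ℵ₀ ≤ μ) (hc : c < μ) :
    2 ^ c ≤ μ := by
  rcases lt_or_ge c ℵ₀ with h0 | h0
  · exact (power_lt_aleph0 (natCast_lt_aleph0 (n := 2)) h0).le.trans hμ
  · rw [h c h0]
    exact Order.succ_le_of_lt hc

/-- By regularity a small subset of `μ` is bounded, so it is a subset of one of `μ` many proper
initial segments, each of which has at most `μ` subsets under GCH. -/
theorem GCH.mk_small_subsets_le (h : GCH.{u}) {μ : Cardinal.{u}} (hμ : μ.IsRegular) {X : Type u}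
    (hX : #X ≤ μ) : #{s : Set X // #s < μ} ≤ μ := by
  have hX' : #X ≤ #μ.ord.ToType := by simpa using hX
  obtain ⟨e⟩ := hX'
  have hb : ∀ s : {s : Set X // #s < μ}, ∃ γ : μ.ord.ToType, ∀ x : s.1, e x < γ := fun s =>
    exists_forall_lt_of_mk_lt hμ s.2 fun x : s.1 => e x
  choose γ hγ using hb
  let F : {s : Set X // #s < μ} → Σ γ : μ.ord.ToType, Set (Iio γ) := fun s =>
    ⟨γ s, {i | ∃ x ∈ s.1, e x = i}⟩
  have hF : Function.Injective F := by
    have aux : ∀ s x, x ∈ s.1 ↔ ∃ i ∈ (F s).2, e x = (i : μ.ord.ToType) := by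
      intro s x
      constructor
      · intro hx
        exact ⟨⟨e x, hγ s ⟨x, hx⟩⟩, ⟨x, hx, rfl⟩, rfl⟩
      · rintro ⟨i, ⟨y, hy, hyi⟩, hxi⟩
        rwa [e.injective (hxi.trans hyi.symm)]
    intro s t hst
    refine Subtype.ext (Set.ext fun x => ?_)
    rw [aux s, aux t, hst]
  refine (mk_le_of_injective hF).trans ?_
  rw [mk_sigma]
  refine (sum_le_sum _ (fun _ => μ) fun i => ?_).trans ?_
  · rw [mk_set]
    exact h.two_power_le hμ.aleph0_le (mk_Iio_ord_toType_lt i)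
  · simp [mul_eq_self hμ.aleph0_le]

/-! ### Conditions -/

variable {κ θ : Cardinal.{u}}

/-- The domain of a condition. -/
def Cond.supp (p : Cond κ θ) : Set θ.ord.ToType := {δ | p.toFun δ ≠ none}

theorem Cond.mk_supp (p : Cond κ θ) : #p.supp < κ := p.small

theorem Cond.notMem_supp {p : Cond κ θ} {δ} : δ ∉ p.supp ↔ p.toFun δ = none := not_not

/-- The empty condition. -/
def Cond.empty (hκ : κ.IsRegular) : Cond κ θ := ⟨fun _ => none, by simpa using hκ.pos⟩

theorem Cond.supp_empty (hκ : κ.IsRegular) : (Cond.empty hκ : Cond κ θ).supp = ∅ := by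
  ext; simp [supp, empty]

/-- The restriction of a condition to a set of coordinates. -/
noncomputable def Cond.restrict (p : Cond κ θ) (C : Set θ.ord.ToType) : Cond κ θ where
  toFun δ := by classical exact if δ ∈ C then p.toFun δ else none
  small := lt_of_le_of_lt (mk_le_mk_of_subset fun δ h => by
    by_contra hd; exact h (by split_ifs <;> simp_all [supp])) p.mk_supp

theorem Cond.supp_restrict (p : Cond κ θ) (C : Set θ.ord.ToType) : (p.restrict C).supp ⊆ C := by
  intro δ h
  by_contra hd
  exact h (by simp [restrict, hd])

/-- The union of two conditions (the first one has priority). -/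
noncomputable def Cond.merge (hκ : κ.IsRegular) (q p : Cond κ θ) : Cond κ θ where
  toFun δ := (q.toFun δ).or (p.toFun δ)
  small := by
    refine lt_of_le_of_lt (mk_le_mk_of_subset (t := q.supp ∪ p.supp) fun δ h => ?_) <|
      (mk_union_le _ _).trans_lt (add_lt_of_lt hκ.aleph0_le q.mk_supp p.mk_supp)
    by_contra hd
    simp only [mem_union, not_or, notMem_supp] at hd
    exact h (by simp [hd.1, hd.2])

theorem Cond.supp_merge (hκ : κ.IsRegular) (q p : Cond κ θ) :
    (q.merge hκ p).supp ⊆ q.supp ∪ p.supp := by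
  intro δ h
  by_contra hd
  simp only [mem_union, not_or, notMem_supp] at hd
  exact h (by simp [merge, hd.1, hd.2])

theorem Cond.merge_le_left (hκ : κ.IsRegular) (q p : Cond κ θ) : q.merge hκ p ≤ q := by
  intro δ i h
  simp [merge, h]

/-- Priority of `q` destroys nothing: on `C` it extends `p`, and outside `C` it is undefined. -/
theorem Cond.merge_le_right (hκ : κ.IsRegular) {q p : Cond κ θ} {C : Set θ.ord.ToType}
    (hq : q.supp ⊆ C) (hqp : q ≤ p.restrict C) : q.merge hκ p ≤ p := by
  intro δ i h
  by_cases hd : δ ∈ C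
  · have : q.toFun δ = some i := hqp δ i (by simpa [restrict, hd] using h)
    simp [merge, this]
  · have : q.toFun δ = none := notMem_supp.mp fun h' => hd (hq h')
    simp [merge, this, h]

/-- Extension of a condition by one value. -/
noncomputable def Cond.extend (hκ : κ.IsRegular) (p : Cond κ θ) (δ : θ.ord.ToType)
    (i : κ.ord.ToType) : Cond κ θ where
  toFun := by classical exact Function.update p.toFun δ (some i)
  small := by
    refine lt_of_le_of_lt (mk_le_mk_of_subset (t := p.supp ∪ {δ}) fun ε h => ?_) <|
      (mk_union_le _ _).trans_lt (add_lt_of_lt hκ.aleph0_le p.mk_supp (by simpa using hκ.nat_lt 1))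
    by_cases he : ε = δ
    · exact Or.inr he
    · have h' : Function.update p.toFun δ (some i) ε ≠ none := h
      rw [Function.update_of_ne he] at h'
      exact Or.inl h'

theorem Cond.extend_apply (hκ : κ.IsRegular) (p : Cond κ θ) (δ : θ.ord.ToType)
    (i : κ.ord.ToType) : (p.extend hκ δ i).toFun δ = some i := by simp [extend]

theorem Cond.extend_le (hκ : κ.IsRegular) {p : Cond κ θ} {δ : θ.ord.ToType}
    (i : κ.ord.ToType) (h : δ ∉ p.supp) : p.extend hκ δ i ≤ p := by
  intro ε j hj
  have : ε ≠ δ := by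
    rintro rfl
    exact h (by simp [supp, hj])
  simpa [extend, this] using hj

theorem Cond.supp_extend (hκ : κ.IsRegular) (p : Cond κ θ) (δ : θ.ord.ToType)
    (i : κ.ord.ToType) : (p.extend hκ δ i).supp ⊆ insert δ p.supp := by
  intro ε h
  by_cases he : ε = δ
  · exact Or.inl he
  · exact Or.inr (by simpa [extend, he, supp] using h)

/-- Chains of fewer than `κ` conditions have lower bounds. -/
theorem Cond.exists_le_of_chain (hκ : κ.IsRegular) {ι : Type u} (hι : #ι < κ) (f : ι → Cond κ θ)
    (hf : ∀ i j, f i ≤ f j ∨ f j ≤ f i) : ∃ r, (∀ i, r ≤ f i) ∧ r.supp ⊆ ⋃ i, (f i).supp := by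
  classical
  have hsub : ∀ g : θ.ord.ToType → Option κ.ord.ToType,
      (∀ δ, g δ ≠ none → ∃ i, (f i).toFun δ ≠ none) → {δ | g δ ≠ none} ⊆ ⋃ i, (f i).supp :=
    fun g hg δ h => mem_iUnion.mpr (hg δ h)
  let g : θ.ord.ToType → Option κ.ord.ToType := fun δ =>
    if h : ∃ i, (f i).toFun δ ≠ none then (f h.choose).toFun δ else none
  have hg : ∀ δ, g δ ≠ none → ∃ i, (f i).toFun δ ≠ none := by
    intro δ h
    by_contra h'
    exact h (by simp only [g, dif_neg h'])
  refine ⟨⟨g, lt_of_le_of_lt (mk_le_mk_of_subset (hsub g hg)) <|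
    (card_iUnion_lt_iff_forall_of_isRegular hκ hι).mpr fun i => (f i).mk_supp⟩, ?_, hsub g hg⟩
  intro i δ v hv
  have h : ∃ i, (f i).toFun δ ≠ none := ⟨i, by simp [hv]⟩
  simp only [g, dif_pos h]
  obtain ⟨w, hw⟩ := Option.ne_none_iff_exists'.mp h.choose_spec
  rcases hf i h.choose with hle | hle
  · have := hle δ w hw
    rw [hw, ← this, hv]
  · exact hle δ v hv

/-- Fusion of fewer than `κ` extension steps, with control of the domains. -/
theorem Cond.exists_fusion (hκ : κ.IsRegular) {I : Type u} [LinearOrder I] [WellFoundedLT I]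
    (hI : #I < κ) (T : I → Set (Cond κ θ)) (p₀ : Cond κ θ) (C : I → Set θ.ord.ToType)
    (step : ∀ i, ∀ p ≤ p₀, p.supp ⊆ p₀.supp ∪ ⋃ j : Iio i, C j →
      ∃ q ≤ p, q ∈ T i ∧ q.supp ⊆ p₀.supp ∪ C i) :
    ∃ p ≤ p₀, p.supp ⊆ p₀.supp ∪ ⋃ i, C i ∧ ∀ i, ∃ q ∈ T i, p ≤ q := by
  let Good : ∀ i : I, (∀ j, j < i → Cond κ θ) → Cond κ θ → Prop := fun i prev r =>
    r ≤ p₀ ∧ r ∈ T i ∧ r.supp ⊆ p₀.supp ∪ C i ∧ ∀ j (h : j < i), r ≤ prev j h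
  have hne : Nonempty (Cond κ θ) := ⟨p₀⟩
  -- The recursion picks a good condition if there is one; that one always exists is proved
  -- afterwards by induction.
  let r : I → Cond κ θ := WellFoundedLT.fix (motive := fun _ => Cond κ θ)
    fun i prev => Classical.epsilon (Good i prev)
  have hr : ∀ i, r i = Classical.epsilon (Good i fun j _ => r j) := fun i =>
    WellFoundedLT.fix_eq _ i
  have bound : ∀ J : Set I, (∀ i ∈ J, Good i (fun j _ => r j) (r i)) →
      ∃ p ≤ p₀, (∀ i ∈ J, p ≤ r i) ∧ p.supp ⊆ p₀.supp ∪ ⋃ i : J, C i := by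
    intro J hJ
    -- The extra index `none` carries `p₀`, so that the bound is below `p₀` even when `J` is empty.
    obtain ⟨p, hp, hps⟩ := exists_le_of_chain hκ (ι := Option J) (by
        rw [mk_option]
        exact add_lt_of_lt hκ.aleph0_le ((mk_set_le J).trans_lt hI) (by simpa using hκ.nat_lt 1))
      (fun o => o.elim p₀ fun i => r i) (by
        rintro (_ | i) (_ | j)
        · exact Or.inl le_rfl
        · exact Or.inr (hJ j j.2).1
        · exact Or.inl (hJ i i.2).1
        · rcases lt_trichotomy i.1 j.1 with h | h | h
          · exact Or.inr ((hJ j j.2).2.2.2 i h)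
          · exact Or.inl (le_of_eq (congrArg r h))
          · exact Or.inl ((hJ i i.2).2.2.2 j h))
    refine ⟨p, hp none, fun i hi => hp (some ⟨i, hi⟩), hps.trans (iUnion_subset ?_)⟩
    rintro (_ | i)
    · exact subset_union_left
    · exact (hJ i i.2).2.2.1.trans
        (union_subset_union_right _ (subset_iUnion (fun i : J => C i) i))
  have good : ∀ i, Good i (fun j _ => r j) (r i) := by
    intro i
    induction i using WellFoundedLT.induction with
    | ind i ih =>
      obtain ⟨p, hp, hpr, hps⟩ := bound (Iio i) fun j hj => ih j hj
      obtain ⟨q, hqp, hqT, hqs⟩ := step i p hp hps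
      rw [hr i]
      exact Classical.epsilon_spec
        (p := Good i fun j _ => r j) ⟨q, hqp.trans hp, hqT, hqs, fun j hj => hqp.trans (hpr j hj)⟩
  obtain ⟨p, hp, hpr, hps⟩ := bound univ fun i _ => good i
  refine ⟨p, hp, hps.trans (union_subset_union_right _ (iUnion_subset fun i => ?_)),
    fun i => ⟨r i, (good i).2.1, hpr i trivial⟩⟩
  exact subset_iUnion C i.1

/-- Distributivity: fewer than `κ` dense lower sets have a dense intersection. -/
theorem Cond.exists_le_forall_mem (hκ : κ.IsRegular) {ι : Type u} (hι : #ι < κ)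
    (T : ι → Set (Cond κ θ)) (hT : ∀ i, IsLowerSet (T i)) (C : Set θ.ord.ToType)
    (hd : ∀ i p, p.supp ⊆ C → ∃ q ≤ p, q ∈ T i ∧ q.supp ⊆ C) (p₀ : Cond κ θ) (hp₀ : p₀.supp ⊆ C) :
    ∃ p ≤ p₀, p.supp ⊆ C ∧ ∀ i, p ∈ T i := by
  obtain ⟨_, _⟩ := exists_wellFoundedLT ι
  obtain ⟨p, hp, hps, hpT⟩ := exists_fusion hκ hι T p₀ (fun _ => C) fun i p _ hps => by
    obtain ⟨q, hqp, hqT, hqs⟩ :=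
      hd i p (hps.trans (union_subset hp₀ (iUnion_subset fun _ => le_rfl)))
    exact ⟨q, hqp, hqT, hqs.trans subset_union_right⟩
  refine ⟨p, hp, hps.trans (union_subset hp₀ (iUnion_subset fun _ => le_rfl)), fun i => ?_⟩
  obtain ⟨q, hq, hpq⟩ := hpT i
  exact hT i hpq hq

/-! ### Locally constant functions on conditions -/

/-- The open set on which a function on conditions is locally constant. -/
def Loc {X : Type*} (f : Cond κ θ → X) : Set (Cond κ θ) := {p | ∀ q ≤ p, f q = f p}

theorem isLowerSet_loc {X : Type*} (f : Cond κ θ → X) : IsLowerSet (Loc f) :=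
  fun _ q hqp hp r hr => (hp r (hr.trans hqp)).trans (hp q hqp).symm

/-- A set of conditions is dense. -/
def IsDense (D : Set (Cond κ θ)) : Prop := ∀ p, ∃ q ≤ p, q ∈ D

/-- `f` can be decided by extensions with domain in `C`. -/
def LivesOn {X : Type*} (f : Cond κ θ → X) (C : Set θ.ord.ToType) : Prop :=
  ∀ p : Cond κ θ, p.supp ⊆ C → ∃ q ≤ p, q ∈ Loc f ∧ q.supp ⊆ C

/-- The part of `p` inside `C` is extended to a deciding condition with domain in `C`, which is then
merged back with `p`. -/
theorem LivesOn.mono (hκ : κ.IsRegular) {X : Type*} {f : Cond κ θ → X} {C C' : Set θ.ord.ToType}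
    (h : LivesOn f C) (hC : C ⊆ C') : LivesOn f C' := by
  intro p hp
  obtain ⟨q, hqp, hqL, hqs⟩ := h (p.restrict C) (p.supp_restrict C)
  exact ⟨q.merge hκ p, Cond.merge_le_right hκ hqs hqp,
    isLowerSet_loc f (Cond.merge_le_left hκ q p) hqL,
    (Cond.supp_merge hκ q p).trans (union_subset (hqs.trans hC) hp)⟩

theorem LivesOn.exists_compatible (hκ : κ.IsRegular) {X : Type*} {f : Cond κ θ → X}
    {C : Set θ.ord.ToType} (h : LivesOn f C) (p : Cond κ θ) :
    ∃ q ∈ Loc f, q.supp ⊆ C ∧ ∃ r ≤ p, r ≤ q := by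
  obtain ⟨q, hqp, hqL, hqs⟩ := h (p.restrict C) (p.supp_restrict C)
  exact ⟨q, hqL, hqs, q.merge hκ p, Cond.merge_le_right hκ hqs hqp, Cond.merge_le_left hκ q p⟩

/-- The conditions with domain in a small set. -/
theorem mk_supp_subset_le (h : GCH.{u}) (hκ : κ.IsRegular) {C : Set θ.ord.ToType} (hC : #C ≤ κ) :
    #{p : Cond κ θ // p.supp ⊆ C} ≤ κ := by
  have hX : #(C × κ.ord.ToType) ≤ κ := by
    rw [mk_prod, lift_id, lift_id]
    exact mul_le_of_le hκ.aleph0_le hC (by simp)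
  refine le_trans ?_ (h.mk_small_subsets_le hκ hX)
  have hsm : ∀ p : Cond κ θ, #{x : C × κ.ord.ToType | p.toFun x.1 = some x.2} < κ := by
    intro p
    refine lt_of_le_of_lt (mk_le_of_injective (β := p.supp)
      (f := fun x => ⟨x.1.1, by simp [Cond.supp, x.2.out]⟩) ?_) p.mk_supp
    rintro ⟨⟨δ, i⟩, hx⟩ ⟨⟨ε, j⟩, hy⟩ hxy
    obtain rfl : δ = ε := Subtype.ext (congrArg (fun z : p.supp => z.1) hxy)
    have : some i = some j := hx.out.symm.trans hy.out
    simp only [Option.some.injEq] at this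
    subst this
    rfl
  refine mk_le_of_injective (f := fun p => ⟨_, hsm p.1⟩) ?_
  have aux : ∀ p q : Cond κ θ, p.supp ⊆ C → {x : C × κ.ord.ToType | p.toFun x.1 = some x.2} =
      {x : C × κ.ord.ToType | q.toFun x.1 = some x.2} → q ≤ p := by
    intro p q hp hpq δ i hi
    have hδ : δ ∈ C := hp (by simp [Cond.supp, hi])
    have : ((⟨δ, hδ⟩, i) : C × κ.ord.ToType) ∈ {x : C × κ.ord.ToType | p.toFun x.1 = some x.2} := hi
    rw [hpq] at this
    exact this
  rintro ⟨p, hp⟩ ⟨q, hq⟩ hpq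
  have hpq' := Subtype.ext_iff.mp hpq
  exact Subtype.ext (le_antisymm (aux q p hq hpq'.symm) (aux p q hp hpq'))

theorem mk_cond_le (h : GCH.{u}) (hθ : θ.IsRegular) (hκθ : κ ≤ θ) : #(Cond κ θ) ≤ θ := by
  have hX : #(θ.ord.ToType × κ.ord.ToType) ≤ θ := by
    rw [mk_prod, lift_id, lift_id]
    exact mul_le_of_le hθ.aleph0_le (by simp) (by simpa)
  refine le_trans ?_ (h.mk_small_subsets_le hθ hX)
  have hsm : ∀ p : Cond κ θ,
      #{x : θ.ord.ToType × κ.ord.ToType | p.toFun x.1 = some x.2} < θ := by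
    intro p
    refine lt_of_le_of_lt (mk_le_of_injective (β := p.supp)
      (f := fun x => ⟨x.1.1, by simp [Cond.supp, x.2.out]⟩) ?_) (p.mk_supp.trans_le hκθ)
    rintro ⟨⟨δ, i⟩, hx⟩ ⟨⟨ε, j⟩, hy⟩ hxy
    obtain rfl : δ = ε := congrArg Subtype.val hxy
    have : some i = some j := hx.out.symm.trans hy.out
    simp only [Option.some.injEq] at this
    subst this
    rfl
  refine mk_le_of_injective (f := fun p => ⟨_, hsm p⟩) ?_
  have aux : ∀ p q : Cond κ θ, {x : θ.ord.ToType × κ.ord.ToType | p.toFun x.1 = some x.2} =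
      {x : θ.ord.ToType × κ.ord.ToType | q.toFun x.1 = some x.2} → q ≤ p := by
    intro p q hpq δ i hi
    have : (δ, i) ∈ {x : θ.ord.ToType × κ.ord.ToType | p.toFun x.1 = some x.2} := hi
    rw [hpq] at this
    exact this
  intro p q hpq
  have hpq' := Subtype.ext_iff.mp hpq
  exact le_antisymm (aux q p hpq'.symm) (aux p q hpq')

/-- Every densely locally constant function is decided by at most `κ` coordinates. -/
theorem exists_livesOn (h : GCH.{u}) (hκ : κ.IsRegular) {X : Type*} {f : Cond κ θ → X}
    (hf : IsDense (Loc f)) : ∃ C : Set θ.ord.ToType, #C ≤ κ ∧ LivesOn f C := by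
  choose e hep heL using hf
  let c : Set θ.ord.ToType → Set θ.ord.ToType := fun E =>
    ⋃ p : {p : Cond κ θ // p.supp ⊆ E}, (e p).supp
  have hc : ∀ E : Set θ.ord.ToType, #E ≤ κ → #(c E) ≤ κ := fun E hE =>
    mk_iUnion_le_of_forall_le hκ.aleph0_le (mk_supp_subset_le h hκ hE) fun p => (e p).mk_supp.le
  -- Stage `i` adds the domains of the chosen deciding extensions of all conditions living on
  -- earlier stages. A condition on the union already lives below some stage, since `κ` is regular.
  let D : κ.ord.ToType → Set θ.ord.ToType := WellFoundedLT.fix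
    (motive := fun _ => Set θ.ord.ToType) fun i prev => c (⋃ j : Iio i, prev j j.2)
  have hD : ∀ i, D i = c (⋃ j : Iio i, D j) := fun i => WellFoundedLT.fix_eq _ i
  have hDc : ∀ i, #(D i) ≤ κ := by
    intro i
    induction i using WellFoundedLT.induction with
    | ind i ih =>
      rw [hD]
      exact hc _ (mk_iUnion_le_of_forall_le hκ.aleph0_le (mk_Iio_ord_toType_lt i).le
        fun j => ih j j.2)
  refine ⟨⋃ i, D i, mk_iUnion_le_of_forall_le hκ.aleph0_le (by simp) hDc, fun p hp => ?_⟩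
  choose l hl using fun δ : p.supp => mem_iUnion.mp (hp δ.2)
  obtain ⟨i, hi⟩ := exists_forall_lt_of_mk_lt hκ p.mk_supp l
  have hpi : p.supp ⊆ ⋃ j : Iio i, D j := fun δ hδ =>
    mem_iUnion.mpr ⟨⟨l ⟨δ, hδ⟩, hi _⟩, hl ⟨δ, hδ⟩⟩
  refine ⟨e p, hep p, heL p, subset_trans ?_ (subset_iUnion D i)⟩
  rw [hD]
  exact subset_iUnion (fun p : {p : Cond κ θ // p.supp ⊆ ⋃ j : Iio i, D j} => (e p).supp) ⟨p, hpi⟩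

/-- The values taken locally constantly are few. -/
theorem exists_small_range (h : GCH.{u}) (hκ : κ.IsRegular) {X : Type*} {f : Cond κ θ → X}
    (hf : IsDense (Loc f)) : ∃ (I : Type u) (g : I → Cond κ θ), #I ≤ κ ∧ (∀ i, g i ∈ Loc f) ∧
      ∀ p ∈ Loc f, ∃ i, f p = f (g i) := by
  obtain ⟨C, hC, hfC⟩ := exists_livesOn h hκ hf
  refine ⟨{p : {p : Cond κ θ // p.supp ⊆ C} // p.1 ∈ Loc f}, fun p => p.1.1,
    (mk_subtype_le _).trans (mk_supp_subset_le h hκ hC), fun p => p.2, fun p hp => ?_⟩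
  obtain ⟨q, hq, hqs, r, hrp, hrq⟩ := hfC.exists_compatible hκ p
  exact ⟨⟨⟨q, hqs⟩, hq⟩, (hp r hrp).symm.trans (hq r hrq)⟩

/-! ### The ultrafilter on conditions -/

/-- The conditions which force the `δ`-th generic ordinal to be above `y`. -/
def Above (y : Cond κ θ → κ.ord.ToType) (δ : θ.ord.ToType) : Set (Cond κ θ) :=
  {p | p ∈ Loc y ∧ ∃ i, p.toFun δ = some i ∧ y p < i}

theorem isLowerSet_above (y : Cond κ θ → κ.ord.ToType) (δ : θ.ord.ToType) :
    IsLowerSet (Above y δ) := by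
  rintro p q hqp ⟨hp, i, hi, hlt⟩
  exact ⟨isLowerSet_loc y hqp hp, i, hqp δ i hi, by rwa [hp q hqp]⟩

/-- The coordinates are treated in increasing order. Before stage `ε` only coordinates below `ε`
have been used, so the functions attached to `ε` can be decided below `ε` while the coordinate `ε`
is still free to receive a value above all of theirs. -/
theorem exists_forall_mem_above (hκ : κ.IsRegular) {ι : Type u} (hι : #ι < κ)
    (y : ι → Cond κ θ → κ.ord.ToType) (δ : ι → θ.ord.ToType)
    (hy : ∀ i, LivesOn (y i) (Iio (δ i))) : ∃ p, ∀ i, p ∈ Above (y i) (δ i) := by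
  -- The fusion runs over the range of `δ`, not over `ι`, because several functions may share one
  -- coordinate and must be exceeded by the same value.
  obtain ⟨p, -, -, hp⟩ := Cond.exists_fusion hκ (I := range δ) (mk_range_le.trans_lt hι)
    (fun ε => {p | ∀ i, δ i = ε → p ∈ Above (y i) (δ i)}) (Cond.empty hκ) (fun ε => Iic ε.1) (by
      intro ε p _ hps
      have hps' : p.supp ⊆ Iio ε.1 := by
        rw [Cond.supp_empty, empty_union] at hps
        exact hps.trans (iUnion_subset fun j => Iic_subset_Iio.mpr j.2)
      have hJ : #{i // δ i = ε} < κ := (mk_subtype_le _).trans_lt hι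
      obtain ⟨q, hqp, hqs, hq⟩ := Cond.exists_le_forall_mem hκ hJ (fun i => Loc (y i))
        (fun i => isLowerSet_loc _) (Iio ε.1) (fun i => by have := hy i; rwa [i.2] at this) p hps'
      obtain ⟨γ, hγ⟩ := exists_forall_lt_of_mk_lt hκ hJ fun i => y i q
      have hle := Cond.extend_le hκ (p := q) (δ := ε.1) γ fun h => (lt_irrefl ε.1 (hqs h)).elim
      refine ⟨q.extend hκ ε γ, hle.trans hqp, ?_, ?_⟩
      · rintro i hi
        have hi' := hq ⟨i, hi⟩
        refine ⟨isLowerSet_loc _ hle hi', γ, by rw [hi]; exact Cond.extend_apply hκ q ε γ, ?_⟩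
        rw [hi' _ hle]
        exact hγ ⟨i, hi⟩
      · refine (Cond.supp_extend hκ q ε γ).trans (insert_subset (Or.inr (mem_Iic.mpr le_rfl)) ?_)
        exact fun ζ h => Or.inr (mem_Iic.mpr (mem_Iio.mp (hqs h)).le))
  refine ⟨p, fun i => ?_⟩
  obtain ⟨q, hq, hpq⟩ := hp ⟨δ i, mem_range_self i⟩
  exact isLowerSet_above _ _ hpq (hq i rfl)

theorem exists_ultrafilter_cond (hκ : StronglyCompact κ) :
    ∃ W : Ultrafilter (Cond κ θ), CardinalInterFilter (W : Filter (Cond κ θ)) κ ∧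
      (∀ D, IsLowerSet D → IsDense D → D ∈ W) ∧
      ∀ (y : Cond κ θ → κ.ord.ToType) (δ : θ.ord.ToType), LivesOn y (Iio δ) → Above y δ ∈ W := by
  obtain ⟨-, hreg, hext⟩ := hκ
  let G : Set (Set (Cond κ θ)) := {D | IsLowerSet D ∧ IsDense D}
  let K : Set (Set (Cond κ θ)) := {A | ∃ y δ, LivesOn y (Iio δ) ∧ A = Above y δ}
  have h2 : (2 : Cardinal) < κ := hreg.nat_lt 2
  have hmem : ∀ s, s ∈ Filter.cardinalGenerate (G ∪ K) h2 ↔ _ := fun s =>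
    Filter.mem_cardinalGenerate_iff (hreg := hreg)
  -- Properness: given fewer than `κ` generators, one condition meets all those of the form `Above y
  -- δ`; an extension of it enters the dense ones and stays in the former, which are downward
  -- closed.
  have hne : (Filter.cardinalGenerate (G ∪ K) h2).NeBot := by
    refine ⟨fun hbot => ?_⟩
    obtain ⟨S, hSG, hS, hSe⟩ := (hmem ∅).mp (by rw [hbot]; exact Filter.mem_bot)
    have hJ : ∀ Z : Set (Set (Cond κ θ)), #(S ∩ Z : Set _) < κ := fun Z =>
      (mk_le_mk_of_subset inter_subset_left).trans_lt hS
    choose y δ hy hA using fun A : (S ∩ K : Set _) => A.2.2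
    obtain ⟨p, hp⟩ := exists_forall_mem_above hreg (hJ K) y δ hy
    obtain ⟨q, hqp, -, hq⟩ := Cond.exists_le_forall_mem hreg (hJ G) (fun D => D.1)
      (fun D => D.2.2.1) univ (fun D p _ => by
        obtain ⟨q, hq, hqD⟩ := D.2.2.2 p
        exact ⟨q, hq, hqD, subset_univ _⟩) p (subset_univ _)
    refine hSe (a := q) fun A hAS => ?_
    rcases hSG hAS with hA' | hA'
    · exact hq ⟨A, hAS, hA'⟩
    · have := hp ⟨A, hAS, hA'⟩
      rw [show A = _ from hA ⟨A, hAS, hA'⟩]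
      exact isLowerSet_above _ _ hqp this
  obtain ⟨W, hW, hWc⟩ := hext _ _ hne (Filter.cardinalInter_ofCardinalGenerate _ h2)
  have hsub : ∀ s ∈ G ∪ K, s ∈ W := fun s hs => hW <| (hmem s).mpr
    ⟨{s}, singleton_subset_iff.mpr hs, by simpa using hreg.nat_lt 1, by simp⟩
  exact ⟨W, hWc, fun D h h' => hsub D (Or.inl ⟨h, h'⟩),
    fun y δ h => hsub _ (Or.inr ⟨y, δ, h, rfl⟩)⟩

end BooleanUltrapower

namespace BooleanUltrapower

open Cardinal Set

/-! ### The regular open algebra -/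

section RegularOpen

variable {P : Type u} [PartialOrder P]

theorem LowerSet.mem_heyting_compl {a : LowerSet P} {p : P} : p ∈ aᶜ ↔ ∀ q ≤ p, q ∉ a := by
  rw [← LowerSet.Iic_le, le_compl_iff_disjoint_right, disjoint_iff_inf_le]
  constructor
  · intro h q hq hqa
    exact h (show q ∈ LowerSet.Iic p ⊓ a from ⟨hq, hqa⟩)
  · rintro h q ⟨hq, hqa⟩
    exact h q hq hqa

namespace RegularOpen

theorem mem_toRegular {a : LowerSet P} {p : P} :
    p ∈ (Heyting.Regular.toRegular a).1 ↔ ∀ q ≤ p, ∃ r ≤ q, r ∈ a := by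
  change p ∈ aᶜᶜ ↔ _
  simp only [LowerSet.mem_heyting_compl, not_forall, not_not, exists_prop]

theorem notMem_bot (p : P) : p ∉ (⊥ : RegularOpen P).1 := id

theorem ne_bot_iff {b : RegularOpen P} : b ≠ ⊥ ↔ ∃ p, p ∈ b.1 := by
  constructor
  · intro h
    by_contra! h'
    exact h (Heyting.Regular.coe_injective (SetLike.ext fun p => ⟨fun hp => h' p hp,
      fun hp => (notMem_bot p hp).elim⟩))
  · rintro ⟨p, hp⟩ rfl
    exact notMem_bot p hp

theorem mem_compl {b : RegularOpen P} {p : P} : p ∈ (bᶜ).1 ↔ ∀ q ≤ p, q ∉ b.1 :=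
  LowerSet.mem_heyting_compl

theorem disjoint_iff' {a b : RegularOpen P} : Disjoint a b ↔ ∀ p, p ∈ a.1 → p ∉ b.1 := by
  rw [disjoint_iff]
  constructor
  · intro h p ha hb
    exact notMem_bot p ((congrArg (fun c : RegularOpen P => p ∈ c.1) h).mp ⟨ha, hb⟩)
  · intro h
    by_contra hne
    obtain ⟨p, hp⟩ := ne_bot_iff.mp hne
    exact h p hp.1 hp.2

theorem mem_iff_toRegular_le {b : RegularOpen P} {p : P} :
    p ∈ b.1 ↔ Heyting.Regular.toRegular (LowerSet.Iic p) ≤ b := by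
  rw [Heyting.Regular.gi.gc.le_iff_le, LowerSet.Iic_le]
  rfl

theorem mem_sInf {S : Set (RegularOpen P)} {p : P} : p ∈ (sInf S).1 ↔ ∀ b ∈ S, p ∈ b.1 := by
  simp only [mem_iff_toRegular_le]
  exact le_sInf_iff

/-- The supremum is the regularization of the union. -/
theorem mem_sSup {S : Set (RegularOpen P)} {p : P} :
    p ∈ (sSup S).1 ↔ ∀ q ≤ p, ∃ r ≤ q, ∃ b ∈ S, r ∈ b.1 := by
  have hle : sSup S = Heyting.Regular.toRegular ⟨{r | ∃ b ∈ S, r ∈ b.1},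
      fun p q hqp ⟨b, hb, hp⟩ => ⟨b, hb, b.1.lower hqp hp⟩⟩ := by
    apply le_antisymm
    · refine sSup_le fun b hb => ?_
      intro p hp
      exact mem_toRegular.mpr fun q hq => ⟨q, le_rfl, b, hb, b.1.lower hq hp⟩
    · rw [Heyting.Regular.gi.gc.le_iff_le]
      rintro p ⟨b, hb, hp⟩
      exact (le_sSup hb : b ≤ sSup S) hp
  rw [hle, mem_toRegular]
  rfl

end RegularOpen

end RegularOpen

/-! ### Generic ultrafilters -/

variable {κ θ : Cardinal.{u}}

theorem IsDense.inter {D E : Set (Cond κ θ)} (hD : IsDense D) (hE : IsDense E)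
    (hD' : IsLowerSet D) : IsDense (D ∩ E) := by
  intro p
  obtain ⟨q, hq, hqD⟩ := hD p
  obtain ⟨r, hr, hrE⟩ := hE q
  exact ⟨r, hr.trans hq, hD' hr hqD, hrE⟩

theorem IsDense.mono {D E : Set (Cond κ θ)} (hD : IsDense D) (h : D ⊆ E) : IsDense E := fun p =>
  let ⟨q, hq, hqD⟩ := hD p
  ⟨q, hq, h hqD⟩

theorem loc_comp_subset {X Y : Type*} (f : Cond κ θ → X) (F : X → Y) :
    Loc f ⊆ Loc fun p => F (f p) := fun _ hp q hq => congrArg F (hp q hq)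

theorem isDense_loc_comp {X Y : Type*} {f : Cond κ θ → X} (hf : IsDense (Loc f)) (F : X → Y) :
    IsDense (Loc fun p => F (f p)) := hf.mono (loc_comp_subset f F)

theorem isDense_loc_const {X : Type*} (x : X) : IsDense (Loc fun _ : Cond κ θ => x) :=
  fun p => ⟨p, le_rfl, fun _ _ => rfl⟩

theorem isDense_loc_prod {X Y : Type*} {f : Cond κ θ → X} {g : Cond κ θ → Y}
    (hf : IsDense (Loc f)) (hg : IsDense (Loc g)) : IsDense (Loc fun p => (f p, g p)) :=
  (hf.inter hg (isLowerSet_loc f)).mono fun _ hp q hq => Prod.ext (hp.1 q hq) (hp.2 q hq)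

theorem isDense_loc_pi (hκ : κ.IsRegular) {ι : Type u} (hι : #ι < κ) {X : ι → Type*}
    {f : ∀ i, Cond κ θ → X i} (hf : ∀ i, IsDense (Loc (f i))) :
    IsDense (Loc fun p i => f i p) := by
  intro p
  obtain ⟨q, hq, -, h⟩ := Cond.exists_le_forall_mem hκ hι (fun i => Loc (f i))
    (fun i => isLowerSet_loc _) univ (fun i p _ => by
      obtain ⟨q, hq, h⟩ := hf i p
      exact ⟨q, hq, h, subset_univ _⟩) p (subset_univ _)
  exact ⟨q, hq, fun r hr => funext fun i => h i r hr⟩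

variable (κ θ) in
/-- A `κ`-complete ultrafilter on the set of conditions which contains all dense open sets, and for
which the generic ordinals increase fast. -/
structure GenericUltrafilter where
  toUltrafilter : Ultrafilter (Cond κ θ)
  aleph0_lt : ℵ₀ < κ
  regular : κ.IsRegular
  complete : CardinalInterFilter (toUltrafilter : Filter (Cond κ θ)) κ
  dense_mem : ∀ D, IsLowerSet D → IsDense D → D ∈ toUltrafilter
  above_mem : ∀ (y : Cond κ θ → κ.ord.ToType) (δ : θ.ord.ToType), LivesOn y (Iio δ) →
    Above y δ ∈ toUltrafilter

namespace GenericUltrafilter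

variable (W : GenericUltrafilter κ θ)

/-- The filter of large sets of conditions. -/
abbrev filter : Filter (Cond κ θ) := W.toUltrafilter

instance : CardinalInterFilter W.filter κ := W.complete

theorem eventually_loc {X : Type*} {f : Cond κ θ → X} (hf : IsDense (Loc f)) :
    ∀ᶠ p in W.filter, p ∈ Loc f := W.dense_mem _ (isLowerSet_loc f) hf

/-- The ultrafilter on the regular open algebra given by an ultrafilter on conditions. -/
noncomputable def toBA : BAUltrafilter (CohenAlgebra κ θ) where
  toPFilter := Order.IsPFilter.toPFilter (F := {b | ∀ᶠ p in W.filter, p ∈ b.1}) <|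
    Order.IsPFilter.of_def ⟨⊤, Filter.Eventually.of_forall fun _ => trivial⟩
      (fun a ha b hb => ⟨a ⊓ b, ha.and hb, inf_le_left, inf_le_right⟩)
      fun {_ _} hab ha => Filter.Eventually.mono ha fun _ hp => hab hp
  bot_notMem h := by
    obtain ⟨p, hp⟩ := Filter.Eventually.exists h
    exact RegularOpen.notMem_bot p hp
  mem_or_compl_mem b := by
    have : ∀ᶠ p in W.filter, p ∈ b.1 ∨ p ∈ (bᶜ).1 := by
      refine W.dense_mem {p | p ∈ b.1 ∨ p ∈ (bᶜ).1} ?_ ?_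
      · rintro p q hqp (h | h)
        · exact Or.inl (b.1.lower hqp h)
        · exact Or.inr ((bᶜ).1.lower hqp h)
      · intro p
        by_cases h : ∃ q ≤ p, q ∈ b.1
        · obtain ⟨q, hq, hqb⟩ := h
          exact ⟨q, hq, Or.inl hqb⟩
        · push Not at h
          exact ⟨p, le_rfl, Or.inr (RegularOpen.mem_compl.mpr h)⟩
    exact Ultrafilter.eventually_or.mp this

theorem mem_toBA {b : CohenAlgebra κ θ} : b ∈ W.toBA.toPFilter ↔ ∀ᶠ p in W.filter, p ∈ b.1 :=
  Iff.rfl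

theorem toBA_isComplete : W.toBA.IsComplete κ := by
  intro S hS h
  rw [mem_toBA]
  simp only [RegularOpen.mem_sInf]
  exact (Filter.eventually_cardinal_ball hS).mpr h

end GenericUltrafilter

/-! ### Names as functions on conditions -/

namespace BUPName

/-- The value of a name decided by a condition. -/
noncomputable def eval (x : BUPName (CohenAlgebra κ θ)) (p : Cond κ θ) : ZFSet.{u} := by
  classical exact if h : ∃ a : x.antichain, p ∈ a.1.1 then x.label h.choose else ∅

/-- The set of conditions which decide a name. -/
def dom (x : BUPName (CohenAlgebra κ θ)) : Set (Cond κ θ) := {p | ∃ a : x.antichain, p ∈ a.1.1}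

theorem antichain_unique (x : BUPName (CohenAlgebra κ θ)) {p : Cond κ θ} {a b : x.antichain}
    (ha : p ∈ a.1.1) (hb : p ∈ b.1.1) : a = b := by
  by_contra hne
  exact RegularOpen.disjoint_iff'.mp
    (x.isMaximal.disjoint _ a.2 _ b.2 fun e => hne (Subtype.ext e)) p ha hb

theorem eval_eq (x : BUPName (CohenAlgebra κ θ)) {p : Cond κ θ} {a : x.antichain}
    (ha : p ∈ a.1.1) : x.eval p = x.label a := by
  have h : ∃ a : x.antichain, p ∈ a.1.1 := ⟨a, ha⟩
  rw [eval, dif_pos h, x.antichain_unique h.choose_spec ha]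

theorem isLowerSet_dom (x : BUPName (CohenAlgebra κ θ)) : IsLowerSet x.dom :=
  fun _ _ hqp ⟨a, ha⟩ => ⟨a, a.1.1.lower hqp ha⟩

/-- Maximality is applied to the regular open set generated by `p`. -/
theorem isDense_dom (x : BUPName (CohenAlgebra κ θ)) : IsDense x.dom := by
  intro p
  obtain ⟨a, ha, hd⟩ := x.isMaximal.maximal (Heyting.Regular.toRegular (LowerSet.Iic p))
    (RegularOpen.ne_bot_iff.mpr ⟨p, RegularOpen.mem_iff_toRegular_le.mpr le_rfl⟩)
  rw [RegularOpen.disjoint_iff'] at hd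
  push Not at hd
  obtain ⟨q, hqa, hq⟩ := hd
  obtain ⟨r, hr, hrp⟩ := RegularOpen.mem_toRegular.mp hq q le_rfl
  exact ⟨r, hrp, ⟨a, ha⟩, a.1.lower hr hqa⟩

theorem dom_subset_loc (x : BUPName (CohenAlgebra κ θ)) : x.dom ⊆ Loc x.eval := by
  rintro p ⟨a, ha⟩ q hq
  rw [x.eval_eq ha, x.eval_eq (a.1.1.lower hq ha)]

theorem isDense_loc_eval (x : BUPName (CohenAlgebra κ θ)) : IsDense (Loc x.eval) :=
  x.isDense_dom.mono x.dom_subset_loc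

/-- Almost every condition decides both names, and below such a condition the only labels that
matter are the two decided ones. -/
theorem val_mem_iff (W : GenericUltrafilter κ θ) (R : ZFSet.{u} → ZFSet.{u} → Prop)
    (x y : BUPName (CohenAlgebra κ θ)) :
    x.val R y ∈ W.toBA.toPFilter ↔ ∀ᶠ p in W.filter, R (x.eval p) (y.eval p) := by
  have hxy : ∀ᶠ p in W.filter, p ∈ x.dom ∧ p ∈ y.dom :=
    Filter.Eventually.and (W.dense_mem _ x.isLowerSet_dom x.isDense_dom)
      (W.dense_mem _ y.isLowerSet_dom y.isDense_dom)
  rw [W.mem_toBA]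
  refine Filter.eventually_congr (hxy.mono ?_)
  rintro p ⟨⟨a, ha⟩, ⟨b, hb⟩⟩
  rw [val, RegularOpen.mem_sSup, x.eval_eq ha, y.eval_eq hb]
  constructor
  · intro h
    obtain ⟨r, hr, _, ⟨a', b', hR, rfl⟩, hra, hrb⟩ := h p le_rfl
    rwa [x.antichain_unique (a.1.1.lower hr ha) hra, y.antichain_unique (b.1.1.lower hr hb) hrb]
  · intro hR q hq
    exact ⟨q, le_rfl, _, ⟨a, b, hR, rfl⟩, a.1.1.lower hq ha, b.1.1.lower hq hb⟩

end BUPName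

/-! ### Names obtained from densely locally constant functions -/

section NameOf

variable {X : Type*} (f : Cond κ θ → X)

/-- The Boolean value of `f = v`. -/
noncomputable def piece (v : X) : CohenAlgebra κ θ :=
  Heyting.Regular.toRegular ⟨{p | ∀ q ≤ p, f q = v}, fun _ _ h hp q hq => hp q (hq.trans h)⟩

theorem mem_piece {v : X} {p : Cond κ θ} :
    p ∈ (piece f v).1 ↔ ∀ q ≤ p, ∃ r ≤ q, ∀ s ≤ r, f s = v := RegularOpen.mem_toRegular

theorem mem_piece_of_loc {p : Cond κ θ} (hp : p ∈ Loc f) : p ∈ (piece f (f p)).1 :=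
  (mem_piece f).mpr fun q hq => ⟨q, le_rfl, fun s hs => hp s (hs.trans hq)⟩

theorem piece_unique {v w : X} {p : Cond κ θ} (hv : p ∈ (piece f v).1) (hw : p ∈ (piece f w).1) :
    v = w := by
  obtain ⟨r, hr, hrv⟩ := (mem_piece f).mp hv p le_rfl
  obtain ⟨s, hs, hsw⟩ := (mem_piece f).mp hw r hr
  exact (hrv s hs).symm.trans (hsw s le_rfl)

variable {f}

/-- The name of `l ∘ f`, for a function `f` which is locally constant on a dense set. -/
noncomputable def nameOf (hf : IsDense (Loc f)) (l : X → ZFSet.{u}) :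
    BUPName (CohenAlgebra κ θ) where
  antichain := {b | ∃ p ∈ Loc f, piece f (f p) = b}
  isMaximal :=
    { ne_bot := by
        rintro _ ⟨p, hp, rfl⟩
        exact RegularOpen.ne_bot_iff.mpr ⟨p, mem_piece_of_loc f hp⟩
      disjoint := by
        rintro _ ⟨p, hp, rfl⟩ _ ⟨q, hq, rfl⟩ hne
        refine RegularOpen.disjoint_iff'.mpr fun r h h' => hne ?_
        rw [piece_unique f h h']
      maximal := by
        intro b hb
        obtain ⟨p, hp⟩ := RegularOpen.ne_bot_iff.mp hb
        obtain ⟨q, hq, hqL⟩ := hf p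
        refine ⟨_, ⟨q, hqL, rfl⟩, fun hd => ?_⟩
        exact RegularOpen.disjoint_iff'.mp hd q (mem_piece_of_loc f hqL) (b.1.lower hq hp) }
  label a := l (f a.2.choose)

theorem eval_nameOf (hf : IsDense (Loc f)) (l : X → ZFSet.{u}) {p : Cond κ θ} (hp : p ∈ Loc f) :
    (nameOf hf l).eval p = l (f p) := by
  let a : (nameOf hf l).antichain := ⟨piece f (f p), p, hp, rfl⟩
  have ha : p ∈ a.1.1 := mem_piece_of_loc f hp
  rw [BUPName.eval_eq _ ha]
  have h := a.2.choose_spec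
  -- The label was read off at a chosen condition that may differ from `p`; having the same piece
  -- forces the same value of `f`.
  have h1 : p ∈ (piece f (f a.2.choose)).1 := by rw [h.2]; exact ha
  exact congrArg l (piece_unique f h1 ha)

theorem exists_label_nameOf (hf : IsDense (Loc f)) (l : X → ZFSet.{u})
    (a : (nameOf hf l).antichain) : ∃ p ∈ Loc f, (nameOf hf l).label a = l (f p) :=
  ⟨a.2.choose, a.2.choose_spec.1, rfl⟩

end NameOf

/-! ### The Boolean ultrapower in terms of functions on conditions -/

variable (κ θ) in
/-- Functions from conditions to sets which are locally constant on a dense set. -/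
abbrev CFun : Type (u + 1) := {f : Cond κ θ → ZFSet.{u} // IsDense (Loc f)}

/-- The constant function. -/
def CFun.const (v : ZFSet.{u}) : CFun κ θ := ⟨fun _ => v, isDense_loc_const v⟩

namespace GenericUltrafilter

variable (W : GenericUltrafilter κ θ)

/-- The class of a function in the Boolean ultrapower. -/
noncomputable def cls (f : CFun κ θ) : Ultrapower W.toBA := Ultrapower.mk W.toBA (nameOf f.2 id)

theorem mk_eq_mk {x y : BUPName (CohenAlgebra κ θ)} :
    Ultrapower.mk W.toBA x = Ultrapower.mk W.toBA y ↔ ∀ᶠ p in W.filter, x.eval p = y.eval p := by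
  rw [← BUPName.val_mem_iff]
  exact Quotient.eq

theorem mem_mk_mk {x y : BUPName (CohenAlgebra κ θ)} :
    Ultrapower.Mem W.toBA (Ultrapower.mk W.toBA x) (Ultrapower.mk W.toBA y) ↔
      ∀ᶠ p in W.filter, x.eval p ∈ y.eval p := by
  rw [← BUPName.val_mem_iff (R := (· ∈ ·))]
  rfl

theorem eventually_eval_nameOf {X : Type*} {f : Cond κ θ → X} (hf : IsDense (Loc f))
    (l : X → ZFSet.{u}) : ∀ᶠ p in W.filter, (nameOf hf l).eval p = l (f p) :=
  (W.eventually_loc hf).mono fun _ hp => eval_nameOf hf l hp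

theorem mk_eq_cls (x : BUPName (CohenAlgebra κ θ)) :
    Ultrapower.mk W.toBA x = W.cls ⟨x.eval, x.isDense_loc_eval⟩ :=
  W.mk_eq_mk.mpr ((W.eventually_eval_nameOf x.isDense_loc_eval id).mono fun _ h => h.symm)

theorem cls_surjective : Function.Surjective W.cls := fun z => by
  induction z using Quotient.inductionOn with
  | h x => exact ⟨_, (W.mk_eq_cls x).symm⟩

theorem cls_eq_cls {f g : CFun κ θ} : W.cls f = W.cls g ↔ ∀ᶠ p in W.filter, f.1 p = g.1 p := by
  rw [cls, cls, mk_eq_mk]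
  refine Filter.eventually_congr ?_
  filter_upwards [W.eventually_eval_nameOf f.2 id, W.eventually_eval_nameOf g.2 id] with p h h'
  rw [h, h']
  rfl

theorem mem_cls_cls {f g : CFun κ θ} : Ultrapower.Mem W.toBA (W.cls f) (W.cls g) ↔
    ∀ᶠ p in W.filter, f.1 p ∈ g.1 p := by
  rw [cls, cls, mem_mk_mk]
  refine Filter.eventually_congr ?_
  filter_upwards [W.eventually_eval_nameOf f.2 id, W.eventually_eval_nameOf g.2 id] with p h h'
  rw [h, h']
  rfl

/-! ### Well-foundedness, set-likeness, extensionality and the collapse -/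

theorem wellFounded_mem : WellFounded (Ultrapower.Mem W.toBA) := by
  rw [wellFounded_iff_isEmpty_descending_chain]
  refine ⟨fun ⟨e, he⟩ => ?_⟩
  choose f hf using fun n : ULift.{u} ℕ => W.cls_surjective (e n.down)
  -- As `κ` is uncountable, completeness makes countably many memberships hold at a single
  -- condition, producing a descending chain of actual sets.
  have h : ∀ᶠ p in W.filter, ∀ n : ULift.{u} ℕ, (f ⟨n.down + 1⟩).1 p ∈ (f n).1 p := by
    rw [Filter.eventually_cardinal_forall (by simpa using W.aleph0_lt)]
    intro n
    rw [← W.mem_cls_cls, hf, hf]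
    exact he _
  obtain ⟨p, hp⟩ := h.exists
  exact (wellFounded_iff_isEmpty_descending_chain.mp ZFSet.mem_wf).elim
    ⟨fun n => (f ⟨n⟩).1 p, fun n => hp ⟨n⟩⟩

theorem small_members (x : Ultrapower W.toBA) : Small.{u} {y // Ultrapower.Mem W.toBA y x} := by
  classical
  obtain ⟨f, rfl⟩ := W.cls_surjective x
  -- Members of the class of `f` have representatives with values in this small set; `∅` serves as
  -- default value off the large set.
  let T : Set ZFSet.{u} := insert ∅ (⋃ p, (f.1 p : Set ZFSet.{u}))
  have hT : Small.{u} T := by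
    have (p : Cond κ θ) : Small.{u} (f.1 p : Set ZFSet.{u}) := inferInstanceAs (Small.{u} (f.1 p))
    have : Small.{u} (⋃ p, (f.1 p : Set ZFSet.{u}) : Set ZFSet.{u}) := small_iUnion _
    exact small_insert _ _
  let F : {g : Cond κ θ → T // IsDense (Loc g)} → Ultrapower W.toBA := fun g =>
    W.cls ⟨fun p => (g.1 p).1, isDense_loc_comp g.2 _⟩
  have hF : Small.{u} (range F) := small_range F
  refine small_subset (t := {y | Ultrapower.Mem W.toBA y (W.cls f)}) (s := range F) fun y hy => ?_
  obtain ⟨g, rfl⟩ := W.cls_surjective y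
  let c : ZFSet.{u} → T := fun z => if h : z ∈ T then ⟨z, h⟩ else ⟨∅, mem_insert _ _⟩
  refine ⟨⟨fun p => c (g.1 p), isDense_loc_comp g.2 c⟩, W.cls_eq_cls.mpr ?_⟩
  filter_upwards [W.mem_cls_cls.mp hy] with p hp
  have : g.1 p ∈ T := mem_insert_of_mem _ (mem_iUnion.mpr ⟨p, hp⟩)
  simp [c, this]

instance (x : Ultrapower W.toBA) : Small.{u} {y // Ultrapower.Mem W.toBA y x} := W.small_members x

theorem extensional {x y : Ultrapower W.toBA}
    (h : ∀ z, Ultrapower.Mem W.toBA z x ↔ Ultrapower.Mem W.toBA z y) : x = y := by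
  obtain ⟨f, rfl⟩ := W.cls_surjective x
  obtain ⟨g, rfl⟩ := W.cls_surjective y
  by_contra hne
  rw [W.cls_eq_cls, ← Ultrafilter.eventually_not] at hne
  -- A point of the symmetric difference is chosen as a function of the two values alone, so
  -- composing with it preserves dense local constancy.
  have hex : ∀ a : ZFSet.{u} × ZFSet.{u}, ∃ z, a.1 ≠ a.2 → ¬ (z ∈ a.1 ↔ z ∈ a.2) := by
    rintro ⟨a, b⟩
    by_contra! h'
    exact (h' ∅).1 (ZFSet.ext fun z => (h' z).2)
  choose c hc using hex
  let k : CFun κ θ := ⟨fun p => c (f.1 p, g.1 p), isDense_loc_comp (isDense_loc_prod f.2 g.2) c⟩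
  have hk := h (W.cls k)
  rw [W.mem_cls_cls, W.mem_cls_cls] at hk
  have hd : ∀ᶠ p in W.filter, ¬ (k.1 p ∈ f.1 p ↔ k.1 p ∈ g.1 p) := hne.mono fun p hp => hc _ hp
  by_cases hf : ∀ᶠ p in W.filter, k.1 p ∈ f.1 p
  · obtain ⟨p, h1, h2, h3⟩ := (hf.and ((hk.mp hf).and hd)).exists
    exact h3 (iff_of_true h1 h2)
  · have hg : ¬ ∀ᶠ p in W.filter, k.1 p ∈ g.1 p := fun h' => hf (hk.mpr h')
    rw [← Ultrafilter.eventually_not] at hf hg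
    obtain ⟨p, h1, h2, h3⟩ := (hf.and (hg.and hd)).exists
    exact h3 (iff_of_false h1 h2)

/-- The transitive collapse of the Boolean ultrapower. -/
noncomputable def collapse : Ultrapower W.toBA → ZFSet.{u} :=
  W.wellFounded_mem.fix fun x ih =>
    ZFSet.range fun y : {y // Ultrapower.Mem W.toBA y x} => ih y.1 y.2

theorem mem_collapse {x : Ultrapower W.toBA} {z : ZFSet.{u}} :
    z ∈ W.collapse x ↔ ∃ y, Ultrapower.Mem W.toBA y x ∧ W.collapse y = z := by
  rw [collapse, WellFounded.fix_eq, ← collapse]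
  simp

theorem collapse_injective : Function.Injective W.collapse := by
  intro x
  induction x using W.wellFounded_mem.induction with
  | _ x ih =>
    intro y hxy
    refine W.extensional fun z => ⟨fun hz => ?_, fun hz => ?_⟩
    · have : W.collapse z ∈ W.collapse y := hxy ▸ W.mem_collapse.mpr ⟨z, hz, rfl⟩
      obtain ⟨w, hw, hwz⟩ := W.mem_collapse.mp this
      rwa [ih z hz hwz.symm]
    · have : W.collapse z ∈ W.collapse x := hxy ▸ W.mem_collapse.mpr ⟨z, hz, rfl⟩
      obtain ⟨w, hw, hwz⟩ := W.mem_collapse.mp this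
      rwa [← ih w hw hwz]

theorem isTransitiveCollapse : IsTransitiveCollapse (Ultrapower.Mem W.toBA) W.collapse :=
  ⟨W.collapse_injective, fun _ _ => W.mem_collapse⟩

/-- The element of the transitive collapse given by a function. -/
noncomputable def Φ (f : CFun κ θ) : ZFSet.{u} := W.collapse (W.cls f)

variable {W}

theorem Φ_eq_Φ {f g : CFun κ θ} : W.Φ f = W.Φ g ↔ ∀ᶠ p in W.filter, f.1 p = g.1 p :=
  W.collapse_injective.eq_iff.trans W.cls_eq_cls

theorem mem_Φ {f : CFun κ θ} {z : ZFSet.{u}} :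
    z ∈ W.Φ f ↔ ∃ g : CFun κ θ, (∀ᶠ p in W.filter, g.1 p ∈ f.1 p) ∧ W.Φ g = z := by
  rw [Φ, mem_collapse, W.cls_surjective.exists]
  simp only [W.mem_cls_cls, Φ]

theorem Φ_mem_Φ {f g : CFun κ θ} : W.Φ f ∈ W.Φ g ↔ ∀ᶠ p in W.filter, f.1 p ∈ g.1 p := by
  rw [mem_Φ]
  constructor
  · rintro ⟨h, hg, hh⟩
    filter_upwards [hg, Φ_eq_Φ.mp hh] with p h1 h2
    rwa [← h2]
  · exact fun h => ⟨f, h, rfl⟩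

theorem collapseName_eq (x : BUPName (CohenAlgebra κ θ)) :
    collapseName W.collapse x = W.Φ ⟨x.eval, x.isDense_loc_eval⟩ := by
  rw [collapseName, W.mk_eq_cls, Φ]

theorem embedding_eq (v : ZFSet.{u}) : embedding W.collapse v = W.Φ (.const v) := by
  rw [embedding, collapseName_eq, Φ_eq_Φ]
  refine Filter.Eventually.of_forall fun p => ?_
  exact BUPName.eval_eq (checkName W.toBA v) (a := ⟨⊤, rfl⟩) trivial

theorem mem_collapseClass {z : ZFSet.{u}} :
    z ∈ collapseClass W.collapse ↔ ∃ f : CFun κ θ, W.Φ f = z := by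
  rw [collapseClass, mem_range, W.cls_surjective.exists]
  rfl

theorem Φ_mem_collapseClass (f : CFun κ θ) : W.Φ f ∈ collapseClass W.collapse :=
  mem_collapseClass.mpr ⟨f, rfl⟩

end GenericUltrafilter

end BooleanUltrapower

namespace BooleanUltrapower

open Cardinal Set

variable {κ θ : Cardinal.{u}}

namespace GenericUltrafilter

variable {W : GenericUltrafilter κ θ}

/-! ### The theorem of Łoś -/

instance : W.filter.NeBot := W.toUltrafilter.neBot

theorem isDense_loc_finite {ι : Type} [Finite ι] (hκ : κ.IsRegular) (f : ι → CFun κ θ) :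
    IsDense (Loc fun p i => (f i).1 p) := by
  have h := isDense_loc_pi (ι := ULift.{u} ι) hκ
    ((lt_aleph0_of_finite _).trans_le hκ.aleph0_le) (f := fun i => (f i.down).1)
    fun i => (f i.down).2
  exact isDense_loc_comp h fun g (i : ι) => g ⟨i⟩

/-- The element of `M` given by a function. -/
noncomputable def ΦM (W : GenericUltrafilter κ θ) (f : CFun κ θ) : collapseClass W.collapse :=
  ⟨W.Φ f, Φ_mem_collapseClass f⟩

theorem ΦM_surjective : Function.Surjective W.ΦM := fun ⟨_, hz⟩ =>
  let ⟨f, hf⟩ := mem_collapseClass.mp hz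
  ⟨f, Subtype.ext hf⟩

theorem exists_term_eq_var {α : Type*} (t : setLanguage.Term α) : ∃ i, t = .var i := by
  rcases t with i | ⟨f, _⟩
  · exact ⟨i, rfl⟩
  · exact f.elim

theorem realize_iff_eventually {α : Type} [Finite α] {n : ℕ}
    (φ : setLanguage.BoundedFormula α n) (f : α → CFun κ θ) (g : Fin n → CFun κ θ) :
    φ.Realize (fun i => W.ΦM (f i)) (fun i => W.ΦM (g i)) ↔
      ∀ᶠ p in W.filter, φ.Realize (fun i => (f i).1 p) fun i => (g i).1 p := by
  have hM : ∀ {m : ℕ} (g : Fin m → CFun κ θ),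
      Sum.elim (fun i => W.ΦM (f i)) (fun i => W.ΦM (g i)) = fun i => W.ΦM (Sum.elim f g i) := by
    intro m g; ext i; cases i <;> rfl
  have hV : ∀ {m : ℕ} (g : Fin m → CFun κ θ) (p : Cond κ θ),
      Sum.elim (fun i => (f i).1 p) (fun i => (g i).1 p) = fun i => (Sum.elim f g i).1 p := by
    intro m g p; ext i; cases i <;> rfl
  induction φ with
  | falsum =>
    simpa [FirstOrder.Language.BoundedFormula.Realize] using W.toUltrafilter.neBot.ne
  | equal s t =>
    obtain ⟨i, rfl⟩ := exists_term_eq_var s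
    obtain ⟨j, rfl⟩ := exists_term_eq_var t
    simp only [FirstOrder.Language.BoundedFormula.Realize, FirstOrder.Language.Term.realize_var,
      hM, hV]
    exact Subtype.ext_iff.trans Φ_eq_Φ
  | rel R ts =>
    cases R with
    | mem =>
      obtain ⟨i, hi⟩ := exists_term_eq_var (ts 0)
      obtain ⟨j, hj⟩ := exists_term_eq_var (ts 1)
      simp only [FirstOrder.Language.BoundedFormula.Realize, FirstOrder.Language.Structure.RelMap,
        hM, hV, hi, hj, FirstOrder.Language.Term.realize_var]
      exact Φ_mem_Φ
  | imp φ ψ ih₁ ih₂ =>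
    simp only [FirstOrder.Language.BoundedFormula.realize_imp]
    exact (imp_congr (ih₁ g) (ih₂ g)).trans Ultrafilter.eventually_imp.symm
  | @all n φ ih =>
    simp only [FirstOrder.Language.BoundedFormula.realize_all]
    have hs : ∀ k : CFun κ θ, (Fin.snoc (fun i => W.ΦM (g i)) (W.ΦM k) :
        Fin (n + 1) → collapseClass W.collapse) =
        fun i => W.ΦM ((Fin.snoc g k : Fin (n + 1) → CFun κ θ) i) := by
      intro k; ext i; refine Fin.lastCases ?_ (fun i => ?_) i <;> simp
    have hs' : ∀ (k : CFun κ θ) (p : Cond κ θ), (Fin.snoc (fun i => (g i).1 p) (k.1 p) :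
        Fin (n + 1) → ZFSet.{u}) =
        fun i => ((Fin.snoc g k : Fin (n + 1) → CFun κ θ) i).1 p := by
      intro k p; ext i; refine Fin.lastCases ?_ (fun i => ?_) i <;> simp
    rw [ΦM_surjective.forall]
    simp only [hs, ih]
    simp only [← hs']
    constructor
    · intro h
      -- The counterexample depends only on the values of the parameters, hence is itself a densely
      -- locally constant function of the condition and can be substituted in `h`.
      have hex : ∀ a : (α → ZFSet.{u}) × (Fin n → ZFSet.{u}), ∃ z,
          (∃ w, ¬ φ.Realize a.1 (Fin.snoc a.2 w)) → ¬ φ.Realize a.1 (Fin.snoc a.2 z) := by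
        intro a
        by_cases hw : ∃ w, ¬ φ.Realize a.1 (Fin.snoc a.2 w)
        · exact ⟨hw.choose, fun _ => hw.choose_spec⟩
        · exact ⟨∅, fun h => (hw h).elim⟩
      choose c hc using hex
      have hd := isDense_loc_comp
        (isDense_loc_prod (isDense_loc_finite W.regular f) (isDense_loc_finite W.regular g)) c
      refine (h ⟨_, hd⟩).mono fun p hp => ?_
      by_contra! hw
      exact hc (fun i => (f i).1 p, fun i => (g i).1 p) hw hp
    · exact fun h k => h.mono fun p hp => hp _

theorem isElementary : IsElementary (collapseClass W.collapse) (embedding W.collapse) := by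
  refine ⟨⟨fun v => W.ΦM (.const v), fun n φ x => ?_⟩, fun v => (embedding_eq v).symm⟩
  have h := realize_iff_eventually (W := W) φ (fun i => .const (x i)) Fin.elim0
  have e : (fun i : Fin 0 => W.ΦM (Fin.elim0 i)) = default := Subsingleton.elim _ _
  rw [e] at h
  refine h.trans ((Filter.eventually_congr (Filter.Eventually.of_forall fun p => ?_)).trans
    (Filter.eventually_const (f := W.filter) (p := φ.Realize x)))
  exact iff_of_eq (congrArg (FirstOrder.Language.BoundedFormula.Realize φ x)
    (Subsingleton.elim _ _))

/-! ### Completeness -/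

/-- If every alternative failed almost everywhere, completeness would make all of them fail at once.
-/
theorem exists_eventually {ι : Type u} (hι : #ι < κ) {P : ι → Cond κ θ → Prop}
    (h : ∀ᶠ p in W.filter, ∃ i, P i p) : ∃ i, ∀ᶠ p in W.filter, P i p := by
  by_contra! h'
  have h2 : ∀ᶠ p in W.filter, ∀ i, ¬ P i p :=
    (Filter.eventually_cardinal_forall hι).mpr h'
  obtain ⟨p, ⟨i, hi⟩, hp⟩ := (h.and h2).exists
  exact hp i hi

theorem Φ_range {ι : Type u} (hι : #ι < κ) (f : ι → CFun κ θ) :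
    W.Φ ⟨fun p => ZFSet.range fun i => (f i).1 p,
      isDense_loc_comp (isDense_loc_pi W.regular hι fun i => (f i).2) ZFSet.range⟩ =
      ZFSet.range fun i => W.Φ (f i) := by
  ext z
  rw [mem_Φ, ZFSet.mem_range]
  constructor
  · rintro ⟨g, hg, rfl⟩
    simp only [ZFSet.mem_range] at hg
    obtain ⟨i, hi⟩ := exists_eventually hι hg
    exact ⟨i, Φ_eq_Φ.mpr hi⟩
  · rintro ⟨i, rfl⟩
    exact ⟨f i, Filter.Eventually.of_forall fun p => ZFSet.mem_range.mpr ⟨i, rfl⟩, rfl⟩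

theorem Φ_unordered_pair (f g : CFun κ θ) :
    W.Φ ⟨fun p => {f.1 p, g.1 p}, isDense_loc_comp (isDense_loc_prod f.2 g.2) fun a => {a.1, a.2}⟩ =
      {W.Φ f, W.Φ g} := by
  ext z
  rw [mem_Φ, ZFSet.mem_pair]
  simp only [ZFSet.mem_pair, Ultrafilter.eventually_or]
  constructor
  · rintro ⟨k, hk, rfl⟩
    exact hk.imp Φ_eq_Φ.mpr Φ_eq_Φ.mpr
  · rintro (rfl | rfl)
    · exact ⟨f, Or.inl (Filter.Eventually.of_forall fun _ => rfl), rfl⟩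
    · exact ⟨g, Or.inr (Filter.Eventually.of_forall fun _ => rfl), rfl⟩

/-- The pointwise ordered pair of two functions. -/
def _root_.BooleanUltrapower.CFun.pair (f g : CFun κ θ) : CFun κ θ :=
  ⟨fun p => ZFSet.pair (f.1 p) (g.1 p),
    isDense_loc_comp (isDense_loc_prod f.2 g.2) fun a => a.1.pair a.2⟩

/-- Singletons in the Kuratowski pair are treated as unordered pairs, so the unordered case
suffices. -/
theorem Φ_pair (f g : CFun κ θ) : W.Φ (f.pair g) = ZFSet.pair (W.Φ f) (W.Φ g) := by
  have h1 := Φ_unordered_pair (W := W) f f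
  have h2 := Φ_unordered_pair (W := W) f g
  rw [ZFSet.pair, ← h2, ← ZFSet.pair_eq_singleton, ← h1, ← Φ_unordered_pair]
  simp only [ZFSet.pair_eq_singleton]
  rfl

theorem embedding_mem_embedding {v w : ZFSet.{u}} :
    embedding W.collapse v ∈ embedding W.collapse w ↔ v ∈ w := by
  rw [embedding_eq, embedding_eq, Φ_mem_Φ]
  exact Filter.eventually_const (f := W.filter) (p := v ∈ w)

theorem Φ_mem_embedding {f : CFun κ θ} {Y : ZFSet.{u}} :
    W.Φ f ∈ embedding W.collapse Y ↔ ∀ᶠ p in W.filter, f.1 p ∈ Y := by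
  rw [embedding_eq, Φ_mem_Φ]
  rfl

/-- Elements of `j(Y)` are represented by functions with values in `Y`. -/
theorem exists_of_mem_embedding {Y z : ZFSet.{u}} (hz : z ∈ embedding W.collapse Y) :
    ∃ f : CFun κ θ, (∀ p, f.1 p ∈ Y) ∧ W.Φ f = z := by
  classical
  rw [embedding_eq, mem_Φ] at hz
  obtain ⟨g, hg, rfl⟩ := hz
  obtain ⟨p₀, hp₀⟩ := hg.exists
  refine ⟨⟨fun p => if g.1 p ∈ Y then g.1 p else g.1 p₀,
    isDense_loc_comp g.2 fun z => if z ∈ Y then z else g.1 p₀⟩, fun p => ?_, ?_⟩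
  · dsimp only
    split_ifs with h
    exacts [h, hp₀]
  · exact Φ_eq_Φ.mpr (hg.mono fun p hp => if_pos hp)

theorem coe_embedding_of_card_lt {A : ZFSet.{u}} (hA : A.card < κ) :
    (embedding W.collapse A : Set ZFSet.{u}) = embedding W.collapse '' (A : Set ZFSet.{u}) := by
  ext z
  constructor
  · intro hz
    obtain ⟨f, hf, rfl⟩ := exists_of_mem_embedding (SetLike.mem_coe.mp hz)
    obtain ⟨i, hi⟩ := exists_eventually (W := W) (ι := Shrink A) hA
      (P := fun i p => f.1 p = ((equivShrink A).symm i).1)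
      (Filter.Eventually.of_forall fun p => ⟨equivShrink A ⟨f.1 p, hf p⟩, by simp⟩)
    exact ⟨_, ((equivShrink A).symm i).2, by rw [embedding_eq]; exact (Φ_eq_Φ.mpr hi).symm⟩
  · rintro ⟨v, hv, rfl⟩
    exact embedding_mem_embedding.mpr hv

theorem embedding_toZFSet_of_lt {α : Ordinal.{u}} (hα : α < κ.ord) :
    embedding W.collapse α.toZFSet = α.toZFSet := by
  induction α using WellFoundedLT.induction with
  | ind α ih =>
    refine SetLike.coe_injective ?_
    rw [coe_embedding_of_card_lt (by rw [Ordinal.card_toZFSet]; exact lt_ord.mp hα),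
      Ordinal.coe_toZFSet, image_image]
    exact image_congr fun β hβ => ih β hβ (lt_trans hβ hα)

theorem closedUnderSeq : ClosedUnderSeq (collapseClass W.collapse) κ := by
  intro α hα y f hy hf
  have hι : #(Shrink α.toZFSet) < κ := by
    change α.toZFSet.card < κ
    rw [Ordinal.card_toZFSet]
    exact lt_ord.mp hα
  have hx : ∀ i : Shrink α.toZFSet, ((equivShrink α.toZFSet).symm i).1 ∈ α.toZFSet :=
    fun i => ((equivShrink α.toZFSet).symm i).2
  choose w hw hwu using fun i => hf.2 _ (hx i)
  have hwM : ∀ i, ∃ g : CFun κ θ, W.Φ g = w i := by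
    intro i
    obtain ⟨a, -, b, hb, hab⟩ := ZFSet.mem_prod.mp (hf.1 (hw i))
    rw [(ZFSet.pair_inj.mp hab).2]
    exact mem_collapseClass.mp (hy b hb)
  choose g hg using hwM
  have hpair : ∀ i, W.Φ ((CFun.const ((equivShrink α.toZFSet).symm i).1).pair (g i)) =
      ZFSet.pair ((equivShrink α.toZFSet).symm i).1 (w i) := by
    intro i
    obtain ⟨β, hβ, he⟩ := Ordinal.mem_toZFSet_iff.mp (hx i)
    rw [Φ_pair, hg, ← embedding_eq, ← he, embedding_toZFSet_of_lt (hβ.trans hα)]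
  -- Ordinals below `κ` are fixed by `j`, so the sequence is a set of fewer than `κ` pairs, each
  -- represented by a function; `Φ_range` then represents the whole set.
  have : f = ZFSet.range fun i =>
      W.Φ ((CFun.const ((equivShrink α.toZFSet).symm i).1).pair (g i)) := by
    ext z
    simp only [hpair, ZFSet.mem_range]
    constructor
    · intro hz
      obtain ⟨a, ha, b, -, rfl⟩ := ZFSet.mem_prod.mp (hf.1 hz)
      refine ⟨equivShrink _ ⟨a, ha⟩, ?_⟩
      rw [← hwu (equivShrink _ ⟨a, ha⟩) b (by simpa using hz)]
      simp
    · rintro ⟨i, rfl⟩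
      exact hw i
  rw [this, ← Φ_range hι]
  exact Φ_mem_collapseClass _

/-! ### Names with antichains of size `κ` -/

theorem nonempty_toType (hκ : κ.IsRegular) : Nonempty κ.ord.ToType := by
  rw [← mk_ne_zero_iff]
  simpa using hκ.ne_zero

theorem isDense_loc_apply (hκ : κ.IsRegular) (δ : θ.ord.ToType) :
    IsDense (Loc fun p : Cond κ θ => p.toFun δ) := by
  have hsub : ∀ p : Cond κ θ, δ ∈ p.supp → p ∈ Loc fun p : Cond κ θ => p.toFun δ := by
    intro p hp q hq
    obtain ⟨i, hi⟩ := Option.ne_none_iff_exists'.mp hp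
    exact (hq δ i hi).trans hi.symm
  intro p
  by_cases h : δ ∈ p.supp
  · exact ⟨p, le_rfl, hsub p h⟩
  · refine ⟨p.extend hκ δ ((nonempty_toType hκ).some), Cond.extend_le hκ _ h, hsub _ ?_⟩
    simp [Cond.supp, Cond.extend_apply]

theorem mk_antichain_nameOf_le (h : GCH.{u}) (hκ : κ.IsRegular) {X : Type*} {f : Cond κ θ → X}
    (hf : IsDense (Loc f)) (l : X → ZFSet.{u}) : #(nameOf hf l).antichain ≤ κ := by
  obtain ⟨I, g, hI, hg, hgf⟩ := exists_small_range h hκ hf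
  refine le_trans (mk_le_of_surjective (α := I)
    (f := fun i => ⟨piece f (f (g i)), g i, hg i, rfl⟩) ?_) hI
  rintro ⟨_, p, hp, rfl⟩
  obtain ⟨i, hi⟩ := hgf p hp
  exact ⟨i, Subtype.ext (congrArg (piece f) hi.symm)⟩

/-- Pairing `f` with the value at coordinate `δ` refines the antichain to at least `κ` pieces, since
that coordinate takes every value in `κ`; the label ignores the second component. -/
theorem exists_name (h : GCH.{u}) (δ : θ.ord.ToType) (f : CFun κ θ) :
    ∃ x : BUPName (CohenAlgebra κ θ), #x.antichain = κ ∧ (∀ a, ∃ p, x.label a = f.1 p) ∧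
      collapseName W.collapse x = W.Φ f := by
  have hd := isDense_loc_prod f.2 (isDense_loc_apply W.regular δ)
  refine ⟨nameOf hd Prod.fst, le_antisymm (mk_antichain_nameOf_le h W.regular hd _) ?_, ?_, ?_⟩
  · have hex : ∀ i : κ.ord.ToType, ∃ p ∈ Loc fun p => (f.1 p, p.toFun δ), p.toFun δ = some i := by
      intro i
      obtain ⟨q, hq, hqL⟩ := hd ((Cond.empty W.regular).extend W.regular δ i)
      exact ⟨q, hqL, hq δ i (Cond.extend_apply _ _ _ _)⟩
    choose p hp hpi using hex
    have : #κ.ord.ToType ≤ #(nameOf hd (Prod.fst : _ → ZFSet.{u})).antichain :=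
      mk_le_of_injective (f := fun i => ⟨piece _ _, p i, hp i, rfl⟩) (by
        intro i j hij
        have hij' := Subtype.ext_iff.mp hij
        have h1 := mem_piece_of_loc _ (hp i)
        have h2 : p i ∈ (piece (fun p => (f.1 p, p.toFun δ)) (f.1 (p j), (p j).toFun δ)).1 :=
          (congrArg (fun b : CohenAlgebra κ θ => p i ∈ b.1) hij').mp h1
        have h3 := (Prod.ext_iff.mp (piece_unique _ h1 h2)).2
        simpa [hpi] using h3)
    simpa using this
  · intro a
    obtain ⟨p, -, hp⟩ := exists_label_nameOf hd Prod.fst a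
    exact ⟨p, hp⟩
  · rw [collapseName_eq, Φ_eq_Φ]
    exact W.eventually_eval_nameOf hd Prod.fst

theorem collapseName_mem_embedding {x : BUPName (CohenAlgebra κ θ)} {Y : ZFSet.{u}}
    (hx : ∀ a, x.label a ∈ Y) : collapseName W.collapse x ∈ embedding W.collapse Y := by
  rw [collapseName_eq, Φ_mem_embedding]
  have : ∀ᶠ p in W.filter, p ∈ x.dom := W.dense_mem _ x.isLowerSet_dom x.isDense_dom
  refine this.mono fun p hp => ?_
  obtain ⟨a, ha⟩ := hp
  change x.eval p ∈ Y
  rw [x.eval_eq ha]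
  exact hx a

theorem mem_collapseClass_iff_exists_name (h : GCH.{u}) (δ : θ.ord.ToType) (z : ZFSet.{u}) :
    z ∈ collapseClass W.collapse ↔
      ∃ x : BUPName (CohenAlgebra κ θ), #x.antichain = κ ∧ collapseName W.collapse x = z := by
  constructor
  · intro hz
    obtain ⟨f, rfl⟩ := mem_collapseClass.mp hz
    obtain ⟨x, hx, -, hxf⟩ := exists_name (W := W) h δ f
    exact ⟨x, hx, hxf⟩
  · rintro ⟨x, -, rfl⟩
    exact ⟨_, rfl⟩

theorem mem_embedding_iff_exists_name (h : GCH.{u}) (δ : θ.ord.ToType) (Y z : ZFSet.{u}) :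
    z ∈ embedding W.collapse Y ↔ ∃ x : BUPName (CohenAlgebra κ θ), #x.antichain = κ ∧
      (∀ a, x.label a ∈ Y) ∧ collapseName W.collapse x = z := by
  constructor
  · intro hz
    obtain ⟨f, hf, rfl⟩ := exists_of_mem_embedding hz
    obtain ⟨x, hx, hl, hxf⟩ := exists_name (W := W) h δ f
    refine ⟨x, hx, fun a => ?_, hxf⟩
    obtain ⟨p, hp⟩ := hl a
    exact hp ▸ hf p
  · rintro ⟨x, -, hx, rfl⟩
    exact collapseName_mem_embedding hx

/-! ### Directed orders -/

/-- A representative of `x` has at most `κ` decided values, so directedness bounds them all by one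
element of `D`. -/
theorem exists_embedding_bound (h : GCH.{u}) {l : Cardinal.{u}} {D R : ZFSet.{u}} (hl : κ < l)
    (hD : IsDirectedOrder l D R) {x : ZFSet.{u}} (hx : x ∈ embedding W.collapse D) :
    ∃ s ∈ D, ZFSet.pair x (embedding W.collapse s) ∈ embedding W.collapse R := by
  obtain ⟨f, hf, rfl⟩ := exists_of_mem_embedding hx
  obtain ⟨I, g, hI, -, hgf⟩ := exists_small_range h W.regular f.2
  obtain ⟨t, ht, hA⟩ := hD.directed (ZFSet.range fun i => f.1 (g i))
    (fun z hz => by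
      obtain ⟨i, rfl⟩ := ZFSet.mem_range.mp hz
      exact hf _)
    (lt_of_le_of_lt (by simpa using ZFSet.lift_card_range_le (f := fun i => f.1 (g i)))
      (hI.trans_lt hl))
  refine ⟨t, ht, ?_⟩
  rw [embedding_eq t, ← Φ_pair, Φ_mem_embedding]
  refine (W.eventually_loc f.2).mono fun p hp => ?_
  obtain ⟨i, hi⟩ := hgf p hp
  exact hA _ (ZFSet.mem_range.mpr ⟨i, hi.symm⟩)

end GenericUltrafilter

end BooleanUltrapower

namespace BooleanUltrapower

open Cardinal Set

variable {κ θ : Cardinal.{u}}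

/-! ### Ordinals of the Boolean ultrapower -/

theorem cof_eq_of_strictMono {α β : Ordinal.{u}} {g : α.ToType → Ordinal.{u}} (hg : StrictMono g)
    (hlt : ∀ a, g a < β) (hc : ∀ b < β, ∃ a, b ≤ g a) : β.cof = α.cof := by
  have h := Order.lift_cof_congr_of_strictMono (f := fun a => (⟨g a, hlt a⟩ : Iio β))
    (fun a b hab => hg hab) (by
      rintro ⟨b, hb⟩
      obtain ⟨a, ha⟩ := hc b hb
      exact ⟨_, mem_range_self a, ha⟩)
  rw [Ordinal.cof_toType, Ordinal.cof_Iio, ← Ordinal.lift_cof, lift_id'.{u, u + 1}] at h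
  exact (lift_injective h).symm

variable (κ θ) in
/-- Functions from conditions to ordinals which are locally constant on a dense set. -/
abbrev OFun : Type (u + 1) := {o : Cond κ θ → Ordinal.{u} // IsDense (Loc o)}

/-- The constant function. -/
def OFun.const (α : Ordinal.{u}) : OFun κ θ := ⟨fun _ => α, isDense_loc_const α⟩

/-- The function with the corresponding von Neumann ordinals as values. -/
noncomputable def OFun.toCFun (o : OFun κ θ) : CFun κ θ :=
  ⟨fun p => (o.1 p).toZFSet, isDense_loc_comp o.2 Ordinal.toZFSet⟩

namespace GenericUltrafilter

theorem isTransitive_Φ {W : GenericUltrafilter κ θ} {f : CFun κ θ}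
    (hf : ∀ᶠ p in W.filter, (f.1 p).IsTransitive) : (W.Φ f).IsTransitive := by
  rw [ZFSet.isTransitive_iff_mem_trans]
  intro x y hxy hy
  obtain ⟨g, hg, rfl⟩ := mem_Φ.mp hy
  obtain ⟨k, hk, rfl⟩ := mem_Φ.mp hxy
  refine Φ_mem_Φ.mpr ?_
  filter_upwards [hf, hg, hk] with p h1 h2 h3
  exact h1.subset_of_mem h2 h3

theorem isOrdinal_Φ {W : GenericUltrafilter κ θ} {f : CFun κ θ}
    (hf : ∀ᶠ p in W.filter, (f.1 p).IsOrdinal) : (W.Φ f).IsOrdinal := by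
  refine ZFSet.isOrdinal_iff_forall_mem_isTransitive.mpr
    ⟨isTransitive_Φ (hf.mono fun p h => h.isTransitive), fun y hy => ?_⟩
  obtain ⟨g, hg, rfl⟩ := mem_Φ.mp hy
  exact isTransitive_Φ (hf.mp (hg.mono fun p h h' => (h'.mem h).isTransitive))

/-- The ordinal of the Boolean ultrapower given by a function. -/
noncomputable def ord (W : GenericUltrafilter κ θ) (o : OFun κ θ) : Ordinal.{u} :=
  (W.Φ o.toCFun).rank

variable {W : GenericUltrafilter κ θ}

theorem toZFSet_ord (o : OFun κ θ) : (W.ord o).toZFSet = W.Φ o.toCFun :=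
  (isOrdinal_Φ (Filter.Eventually.of_forall fun _ => ZFSet.isOrdinal_toZFSet _)).toZFSet_rank_eq

theorem ord_lt_ord {o o' : OFun κ θ} : W.ord o < W.ord o' ↔ ∀ᶠ p in W.filter, o.1 p < o'.1 p := by
  rw [← Ordinal.toZFSet_mem_toZFSet_iff, toZFSet_ord, toZFSet_ord, Φ_mem_Φ]
  simp only [OFun.toCFun, Ordinal.toZFSet_mem_toZFSet_iff]

theorem ord_eq_ord {o o' : OFun κ θ} : W.ord o = W.ord o' ↔ ∀ᶠ p in W.filter, o.1 p = o'.1 p := by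
  rw [← Ordinal.toZFSet_injective.eq_iff, toZFSet_ord, toZFSet_ord, Φ_eq_Φ]
  simp only [OFun.toCFun, Ordinal.toZFSet_injective.eq_iff]

theorem ord_le_ord {o o' : OFun κ θ} (h : ∀ᶠ p in W.filter, o.1 p ≤ o'.1 p) :
    W.ord o ≤ W.ord o' := by
  by_contra! hlt
  obtain ⟨p, h1, h2⟩ := (h.and (ord_lt_ord.mp hlt)).exists
  exact h1.not_gt h2

theorem onOrd_embedding (α : Ordinal.{u}) : onOrd (embedding W.collapse) α = W.ord (.const α) := by
  rw [onOrd, embedding_eq]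
  rfl

theorem embedding_toZFSet (α : Ordinal.{u}) :
    embedding W.collapse α.toZFSet = (onOrd (embedding W.collapse) α).toZFSet := by
  rw [onOrd_embedding, toZFSet_ord, embedding_eq]
  rfl

theorem onOrd_strictMono : StrictMono (onOrd (embedding W.collapse)) := fun α β h => by
  rw [onOrd_embedding, onOrd_embedding, ord_lt_ord]
  exact Filter.Eventually.of_forall fun _ => h

theorem exists_of_lt_onOrd {α β : Ordinal.{u}} (h : β < onOrd (embedding W.collapse) α) :
    ∃ o : OFun κ θ, (∀ p, o.1 p < α) ∧ W.ord o = β := by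
  rw [← Ordinal.toZFSet_mem_toZFSet_iff, ← embedding_toZFSet] at h
  obtain ⟨f, hf, hfβ⟩ := exists_of_mem_embedding h
  have hr : ∀ p, (f.1 p).rank < α ∧ (f.1 p).rank.toZFSet = f.1 p := fun p => by
    obtain ⟨a, ha, he⟩ := Ordinal.mem_toZFSet_iff.mp (hf p)
    rw [← he, Ordinal.rank_toZFSet]
    exact ⟨ha, rfl⟩
  refine ⟨⟨fun p => (f.1 p).rank, isDense_loc_comp f.2 ZFSet.rank⟩, fun p => (hr p).1, ?_⟩
  rw [← Ordinal.toZFSet_injective.eq_iff, toZFSet_ord, ← hfβ, Φ_eq_Φ]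
  exact Filter.Eventually.of_forall fun p => (hr p).2

/-! ### Cofinalities -/

theorem onOrd_cofinal (h : GCH.{u}) {α : Ordinal.{u}} (hα : α.cof ≠ κ) {β : Ordinal.{u}}
    (hβ : β < onOrd (embedding W.collapse) α) : ∃ γ < α, β ≤ onOrd (embedding W.collapse) γ := by
  obtain ⟨o, ho, rfl⟩ := exists_of_lt_onOrd hβ
  suffices ∃ γ < α, ∀ᶠ p in W.filter, o.1 p ≤ γ by
    obtain ⟨γ, hγ, hγo⟩ := this
    exact ⟨γ, hγ, by rw [onOrd_embedding]; exact ord_le_ord hγo⟩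
  rcases lt_or_gt_of_ne hα with hlt | hgt
  -- Cofinality below `κ`: completeness selects one element of a short cofinal set that works almost
  -- everywhere.
  · obtain ⟨S, hS, hSc⟩ := Order.exists_cof_eq α.ToType
    rw [Ordinal.cof_toType] at hSc
    obtain ⟨s, hs⟩ := exists_eventually (W := W) (ι := S) (hSc.trans_lt hlt)
      (P := fun s p => o.1 p ≤ (Ordinal.ToType.mk.symm s.1).1)
      (Filter.Eventually.of_forall fun p => by
        obtain ⟨s, hs, hle⟩ := hS (Ordinal.ToType.mk ⟨o.1 p, ho p⟩)
        exact ⟨⟨s, hs⟩, (OrderIso.le_symm_apply _).mpr hle⟩)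
    exact ⟨_, (Ordinal.ToType.mk.symm s.1).2, hs⟩
  -- Cofinality above `κ`: the at most `κ` decided values have a supremum below `α`.
  · obtain ⟨I, g, hI, -, hgo⟩ := exists_small_range h W.regular o.2
    refine ⟨⨆ i, o.1 (g i), Ordinal.iSup_lt_of_lt_cof (hI.trans_lt hgt) fun i => ho _,
      (W.eventually_loc o.2).mono fun p hp => ?_⟩
    obtain ⟨i, hi⟩ := hgo p hp
    rw [hi]
    exact Ordinal.le_iSup (fun i => o.1 (g i)) i

theorem cof_onOrd (h : GCH.{u}) {α : Ordinal.{u}} (hα : α.cof ≠ κ) :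
    (onOrd (embedding W.collapse) α).cof = α.cof := by
  refine cof_eq_of_strictMono
    (g := fun a => onOrd (embedding W.collapse) (Ordinal.ToType.mk.symm a).1)
    (fun a b hab => onOrd_strictMono (Ordinal.ToType.mk.symm.strictMono hab))
    (fun a => onOrd_strictMono (Ordinal.ToType.mk.symm a).2) fun b hb => ?_
  obtain ⟨γ, hγ, hb⟩ := onOrd_cofinal h hα hb
  exact ⟨Ordinal.ToType.mk ⟨γ, hγ⟩, by simpa using hb⟩

/-! ### The image of the critical point -/

/-- The `δ`-th generic ordinal below `κ`. -/
noncomputable def generic (hκ : κ.IsRegular) (δ : θ.ord.ToType) (p : Cond κ θ) : κ.ord.ToType :=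
  (p.toFun δ).getD (nonempty_toType hκ).some

theorem isDense_loc_generic (hκ : κ.IsRegular) (δ : θ.ord.ToType) :
    IsDense (Loc (generic hκ δ : Cond κ θ → _)) :=
  isDense_loc_comp (isDense_loc_apply hκ δ) fun a => a.getD (nonempty_toType hκ).some

theorem livesOn_generic (hκ : κ.IsRegular) {δ δ' : θ.ord.ToType} (h : δ < δ') :
    LivesOn (generic hκ δ : Cond κ θ → _) (Iio δ') := by
  have hsub : ∀ p : Cond κ θ, δ ∈ p.supp → p ∈ Loc (generic hκ δ) := by
    intro p hp q hq
    obtain ⟨i, hi⟩ := Option.ne_none_iff_exists'.mp hp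
    rw [generic, generic, hq δ i hi, hi]
  intro p hp
  by_cases hd : δ ∈ p.supp
  · exact ⟨p, le_rfl, hsub p hd, hp⟩
  · refine ⟨p.extend hκ δ (nonempty_toType hκ).some, Cond.extend_le hκ _ hd, hsub _ ?_,
      (Cond.supp_extend hκ _ _ _).trans (insert_subset h hp)⟩
    simp [Cond.supp, Cond.extend_apply]

/-- The function to ordinals given by a function to `κ`. -/
noncomputable def ofToType {y : Cond κ θ → κ.ord.ToType} (hy : IsDense (Loc y)) : OFun κ θ :=
  ⟨fun p => (Ordinal.ToType.mk.symm (y p)).1,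
    isDense_loc_comp hy fun i => (Ordinal.ToType.mk.symm i).1⟩

theorem ord_lt_generic {y : Cond κ θ → κ.ord.ToType} (hy : IsDense (Loc y)) {δ : θ.ord.ToType}
    (h : LivesOn y (Iio δ)) :
    W.ord (ofToType hy) < W.ord (ofToType (isDense_loc_generic W.regular δ)) := by
  refine ord_lt_ord.mpr (Filter.Eventually.mono (W.above_mem y δ h) ?_)
  rintro p ⟨-, i, hi, hlt⟩
  have : generic W.regular δ p = i := by rw [generic, hi]; rfl
  simp only [ofToType, this]
  exact Ordinal.ToType.mk.symm.strictMono hlt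

theorem ofToType_lt {y : Cond κ θ → κ.ord.ToType} (hy : IsDense (Loc y)) :
    W.ord (ofToType hy) < onOrd (embedding W.collapse) κ.ord := by
  rw [onOrd_embedding, ord_lt_ord]
  exact Filter.Eventually.of_forall fun p => (Ordinal.ToType.mk.symm (y p)).2

theorem cof_onOrd_kappa (h : GCH.{u}) (hθ : θ.IsRegular) (hκθ : κ < θ) :
    (onOrd (embedding W.collapse) κ.ord).cof = θ := by
  rw [cof_eq_of_strictMono (α := θ.ord)
    (g := fun δ => W.ord (ofToType (isDense_loc_generic W.regular δ)))
    (fun δ δ' hδ => ord_lt_generic _ (livesOn_generic W.regular hδ)) (fun δ => ofToType_lt _)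
    fun b hb => ?_, hθ.cof_ord]
  obtain ⟨o, ho, rfl⟩ := exists_of_lt_onOrd hb
  let y : Cond κ θ → κ.ord.ToType := fun p => Ordinal.ToType.mk ⟨o.1 p, ho p⟩
  have hy : IsDense (Loc y) := o.2.mono fun p hp q hq =>
    congrArg Ordinal.ToType.mk (Subtype.ext (hp q hq))
  obtain ⟨C, hC, hyC⟩ := exists_livesOn h W.regular hy
  -- The at most `κ` deciding coordinates are bounded in `θ`, so the generic ordinal at the bound
  -- lies above the given one.
  obtain ⟨δ, hδ⟩ := exists_forall_lt_of_mk_lt hθ (hC.trans_lt hκθ) fun c : C => c.1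
  refine ⟨δ, ?_⟩
  have hlt := ord_lt_generic (W := W) hy
    (hyC.mono W.regular (C' := Iio δ) fun c hc => hδ ⟨c, hc⟩)
  refine le_trans (le_of_eq (ord_eq_ord.mpr ?_)) hlt.le
  exact Filter.Eventually.of_forall fun p => by simp [ofToType, y]

theorem le_onOrd_kappa (h : GCH.{u}) (hθ : θ.IsRegular) (hκθ : κ < θ) :
    θ.ord ≤ onOrd (embedding W.collapse) κ.ord := by
  conv_lhs => rw [← cof_onOrd_kappa (W := W) h hθ hκθ]
  exact Ordinal.ord_cof_le _

theorem isCriticalPoint (h : GCH.{u}) (hθ : θ.IsRegular) (hκθ : κ < θ) :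
    IsCriticalPoint (embedding W.collapse) κ.ord := by
  refine ⟨fun he => ?_, fun β hβ => embedding_toZFSet_of_lt hβ⟩
  rw [embedding_toZFSet] at he
  have := le_onOrd_kappa (W := W) h hθ hκθ
  rw [Ordinal.toZFSet_injective he, Cardinal.ord_le_ord] at this
  exact this.not_gt hκθ

/-! ### Images of regular cardinals -/

theorem card_onOrd_le (h : GCH.{u}) (hθ : θ.IsRegular) (hκθ : κ < θ) {l : Cardinal.{u}}
    (hl : l.IsRegular) : (onOrd (embedding W.collapse) l.ord).card ≤ max θ l := by
  have hμ : (max θ l).IsRegular := by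
    rcases max_choice θ l with hm | hm <;> rw [hm] <;> assumption
  have hX : #(Cond κ θ × l.ord.ToType) ≤ max θ l := by
    rw [mk_prod, lift_id, lift_id]
    exact mul_le_of_le hμ.aleph0_le ((mk_cond_le h hθ hκθ.le).trans (le_max_left _ _))
      (by simp)
  rw [← mk_toType]
  refine le_trans ?_ (h.mk_small_subsets_le hμ hX)
  choose o ho hoe using fun b : (onOrd (embedding W.collapse) l.ord).ToType =>
    exists_of_lt_onOrd (W := W) (α := l.ord) (β := (Ordinal.ToType.mk.symm b).1)
      (Ordinal.ToType.mk.symm b).2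
  choose C hC hoC using fun b => exists_livesOn h W.regular (o b).2
  -- The code is the graph of the representative on deciding conditions living on `C b`; it has at
  -- most `κ` elements, fewer than `max θ l`, so such codes can be counted under GCH.
  let code : (onOrd (embedding W.collapse) l.ord).ToType → Set (Cond κ θ × l.ord.ToType) :=
    fun b => {x | x.1.supp ⊆ C b ∧ x.1 ∈ Loc (o b).1 ∧
      x.2 = Ordinal.ToType.mk ⟨(o b).1 x.1, ho b x.1⟩}
  have hcode : ∀ b, #(code b) < max θ l := by
    intro b
    refine lt_of_le_of_lt (mk_le_of_injective (β := {p : Cond κ θ // p.supp ⊆ C b})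
      (f := fun x => ⟨x.1.1, x.2.1⟩) ?_) ((mk_supp_subset_le h W.regular (hC b)).trans_lt
        (hκθ.trans_le (le_max_left _ _)))
    rintro ⟨⟨p, i⟩, hp⟩ ⟨⟨q, j⟩, hq⟩ hpq
    obtain rfl : p = q := congrArg (fun z : {p : Cond κ θ // p.supp ⊆ C b} => z.1) hpq
    exact Subtype.ext (Prod.ext rfl (hp.2.2.trans hq.2.2.symm))
  refine mk_le_of_injective (f := fun b => ⟨code b, hcode b⟩) fun b c hbc => ?_
  have hbc' : code b = code c := Subtype.ext_iff.mp hbc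
  refine Ordinal.ToType.mk.symm.injective (Subtype.ext ?_)
  rw [← hoe b, ← hoe c, ord_eq_ord]
  filter_upwards [W.eventually_loc (o b).2, W.eventually_loc (o c).2] with p hb hc
  -- A code determines its function almost everywhere: a condition deciding both functions is
  -- compatible with some `q` in the common code, and the values transfer through a common
  -- extension.
  obtain ⟨q, hq, hqs, r, hrp, hrq⟩ := (hoC b).exists_compatible W.regular p
  have hmem : (q, Ordinal.ToType.mk ⟨(o b).1 q, ho b q⟩) ∈ code b := ⟨hqs, hq, rfl⟩
  rw [hbc'] at hmem
  have hval : (o b).1 q = (o c).1 q :=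
    congrArg Subtype.val (Ordinal.ToType.mk.injective hmem.2.2)
  rw [← hb r hrp, hq r hrq, hval, ← hmem.2.1 r hrq, hc r hrp]

theorem onOrd_lt_succ (h : GCH.{u}) (hθ : θ.IsRegular) (hκθ : κ < θ) {l : Cardinal.{u}}
    (hl : l.IsRegular) :
    onOrd (embedding W.collapse) l.ord < (Order.succ (max θ l)).ord :=
  lt_ord.mpr (Order.lt_succ_of_le (card_onOrd_le h hθ hκθ hl))

theorem max_le_onOrd (h : GCH.{u}) (hθ : θ.IsRegular) (hκθ : κ < θ) {l : Cardinal.{u}}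
    (hl : κ < l) : (max θ l).ord ≤ onOrd (embedding W.collapse) l.ord := by
  rcases max_choice θ l with hm | hm <;> rw [hm]
  · exact (le_onOrd_kappa h hθ hκθ).trans (onOrd_strictMono.monotone (Cardinal.ord_le_ord.mpr hl.le))
  · exact onOrd_strictMono.le_apply

end GenericUltrafilter

end BooleanUltrapower

open Cardinal BooleanUltrapower in
theorem mainTheorem6 (κ θ : Cardinal.{u}) (hGCH : GCH.{u}) (hκ : StronglyCompact κ)
    (hθ : θ.IsRegular) (hκθ : κ < θ) :
    ∃ U : BAUltrafilter (CohenAlgebra κ θ), U.IsComplete κ ∧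
    ∃ π : Ultrapower U → ZFSet.{u}, IsTransitiveCollapse (Ultrapower.Mem U) π ∧
    -- (a) elementarity and closure
    (IsElementary (collapseClass π) (embedding π) ∧ ClosedUnderSeq (collapseClass π) κ) ∧
    -- (b) elements of `M` and of `j(Y)` are mixtures of `κ` many possibilities
    ((∀ z : ZFSet.{u}, z ∈ collapseClass π ↔
        ∃ x : BUPName (CohenAlgebra κ θ), #x.antichain = κ ∧ collapseName π x = z) ∧
      (∀ Y z : ZFSet.{u}, z ∈ embedding π Y ↔
        ∃ x : BUPName (CohenAlgebra κ θ), #x.antichain = κ ∧ (∀ a, x.label a ∈ Y) ∧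
          collapseName π x = z)) ∧
    -- (c) small sets
    ((∀ A : ZFSet.{u}, A.card < κ →
        (embedding π A : Set ZFSet.{u}) = embedding π '' (A : Set ZFSet.{u})) ∧
      (∀ α < κ.ord, embedding π α.toZFSet = α.toZFSet)) ∧
    -- `j` maps ordinals to ordinals
    (∀ α : Ordinal.{u}, embedding π α.toZFSet = (onOrd (embedding π) α).toZFSet) ∧
    -- (d) the critical point and its image
    (IsCriticalPoint (embedding π) κ.ord ∧ (onOrd (embedding π) κ.ord).cof = θ ∧
      θ.ord ≤ onOrd (embedding π) κ.ord ∧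
      onOrd (embedding π) κ.ord ≤ (Order.succ θ).ord) ∧
    -- (e) images of regular cardinals above `κ`
    (∀ l : Cardinal.{u}, l.IsRegular → κ < l →
      (max θ l).ord ≤ onOrd (embedding π) l.ord ∧
        onOrd (embedding π) l.ord < (Order.succ (max θ l)).ord) ∧
    -- (f) directed orders
    (∀ (l : Cardinal.{u}) (D R : ZFSet.{u}), κ < l → IsDirectedOrder l D R →
      ∀ x ∈ embedding π D, ∃ s ∈ D, ZFSet.pair x (embedding π s) ∈ embedding π R) ∧
    -- (g) cofinalities other than `κ`
    (∀ α : Ordinal.{u}, α.cof ≠ κ →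
      (∀ β < onOrd (embedding π) α, ∃ γ < α, β ≤ onOrd (embedding π) γ) ∧
        (onOrd (embedding π) α).cof = α.cof) := by
  obtain ⟨W, hWc, hWd, hWa⟩ := exists_ultrafilter_cond (θ := θ) hκ
  let G : GenericUltrafilter κ θ := ⟨W, hκ.1, hκ.2.1, hWc, hWd, hWa⟩
  -- Any coordinate will do; it is used only to enlarge antichains to size exactly `κ`.
  obtain ⟨δ⟩ := GenericUltrafilter.nonempty_toType hθ
  refine ⟨G.toBA, G.toBA_isComplete, G.collapse, G.isTransitiveCollapse,
    ⟨GenericUltrafilter.isElementary, GenericUltrafilter.closedUnderSeq⟩,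
    ⟨GenericUltrafilter.mem_collapseClass_iff_exists_name hGCH δ,
      GenericUltrafilter.mem_embedding_iff_exists_name hGCH δ⟩,
    ⟨fun A hA => GenericUltrafilter.coe_embedding_of_card_lt hA,
      fun α hα => GenericUltrafilter.embedding_toZFSet_of_lt hα⟩,
    GenericUltrafilter.embedding_toZFSet,
    ⟨GenericUltrafilter.isCriticalPoint hGCH hθ hκθ,
      GenericUltrafilter.cof_onOrd_kappa hGCH hθ hκθ,
      GenericUltrafilter.le_onOrd_kappa hGCH hθ hκθ, ?_⟩,
    fun l hl hκl => ⟨GenericUltrafilter.max_le_onOrd hGCH hθ hκθ hκl,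
      GenericUltrafilter.onOrd_lt_succ hGCH hθ hκθ hl⟩,
    fun l D R hl hD x hx => GenericUltrafilter.exists_embedding_bound hGCH hl hD hx,
    fun α hα => ⟨fun β hβ => GenericUltrafilter.onOrd_cofinal hGCH hα hβ,
      GenericUltrafilter.cof_onOrd hGCH hα⟩⟩
  -- The upper bound on `j(κ)` comes from `j(κ) ≤ j(θ)` and the count of `j(θ)`.
  have h := GenericUltrafilter.onOrd_lt_succ (W := G) hGCH hθ hκθ hθ
  rw [max_self] at h
  exact (GenericUltrafilter.onOrd_strictMono.monotone (ord_le_ord.mpr hκθ.le)).trans h.le
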